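/- Let $G$ be a topological group and let $\widetilde E^*=\bigoplus_{n\in\mathbb Z}\widetilde E^n$ be a multiplicative $\mathbb Z$-graded $G$-equivariant cohomology theory, that is: a contravariant functor from pointed $G$-CW complexes (whose base point is a $G$-fixed $0$-cell) and pointed $G$-maps to (non-unital) graded-commutative rings which is invariant under pointed $G$-homotopy; which takes each cofibre sequence $A\to X\to X/A$, with $A$ a pointed subcomplex of $X$, to an exact sequence $\widetilde E^*(X/A)\to\widetilde E^*(X)\to\widetilde E^*(A)$; whose unreduced rings $E^*(X)=\widetilde E^*(X_+)$ have a unit pulled back from $E^0(*)$; and which carries a class $e\in\widetilde E^1(S^1)$ such that the cross product $x\mapsto e\times x$ is a natural isomorphism $\widetilde E^n(X)\to\widetilde E^{n+1}(S^1\wedge X)$. Write $E^*(X,A)=\widetilde E^*(X/A)$ for a $G$-CW pair $(X,A)$. Let $X$ be a $G$-CW complex with subcomplexes $U$ and $V$ such that $X=U\cup V$, put $W=U\cap V$, and let $j\colon W\hookrightarrow X$ be the inclusion. Let $\delta\colon E^*(W)\to E^{*+1}(X)$ be the connecting map of the Mayer–Vietoris sequence of the triad $(X;U,V)$: the composite $$E^*(W)\longrightarrow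 E^{*+1}(V,W)\xleftarrow{\ \cong\ }E^{*+1}(X,U)\longrightarrow E^{*+1}(X)$$ of the connecting map of the pair $(V,W)$ (the suspension isomorphism followed by the map induced by $V/W\xleftarrow{\ \simeq\ }V\cup CW\to S^1\wedge W_+$), the inverse of the excision isomorphism, and the map induced by $X_+\to X/U$. Then $\delta$ is a well-defined additive map of degree $1$, and it is a homomorphism of right $E^*(X)$-modules, where $E^*(X)$ acts on $E^*(W)$ by restriction along $j$: $$\delta\bigl(w\cdot j^*x\bigr)=\delta(w)\cdot x\qquad\text{for all } w\in E^*(W),\ x\in E^*(X).$$ Equivalently, $\delta(j^*x\cdot w)=(-1)^m\,x\cdot\delta(w)$ for $x\in E^m(X)$ and $w\in E^*(W)$. In particular, the image of $\delta$ is a two-sided ideal of $E^*(X)$, and the product of any two of its elements is zero. -/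

import Mathlib

open Topology unitInterval

universe u v

namespace EquivCoh

/-! ### G-CW complexes -/

/-- A `G`-CW complex, for a topological group `G`: a space with an action of `G` which is built by
attaching equivariant cells `G/H × Dⁿ`, with `H` a closed subgroup and with the cube `Iⁿ` as the
model of the disc `Dⁿ`.

A cell `e` has a characteristic map `char e : G/H × Iⁿ → X`, continuous and equivariant.
* `char_bij`: the open cells partition `X`, and each characteristic map is injective on its
  open cell;
* `boundary`: the boundary of an `n`-cell lies in the union of the closed cells of
  dimension `< n`;
* `closed_of` (weak topology): for each finite `n`, a subset `C` of the union of the closed cells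
  of dimension `< n` is closed if its preimages under the characteristic maps of these cells are
  closed (so that each skeleton is a closed subspace, obtained from the preceding one by the pushout
  that attaches its cells); and the same holds for `n = ⊤`, so that `X` is the
  colimit of its skeleta. -/
structure GCW (G : Type u) [Group G] [TopologicalSpace G] where
  carrier : Type u
  [top : TopologicalSpace carrier]
  [act : MulAction G carrier]
  Cell : Type u
  dim : Cell → ℕ
  stab : Cell → Subgroup G
  stab_closed : ∀ e, IsClosed (stab e : Set G)
  char : ∀ e, (G ⧸ stab e) × (Fin (dim e) → I) → carrier
  continuous_char : ∀ e, Continuous (char e)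
  char_smul : ∀ e (g : G) (a : G ⧸ stab e) (t : Fin (dim e) → I),
    char e (g • a, t) = g • char e (a, t)
  char_bij : ∀ x, ∃! p : (Σ e, (G ⧸ stab e) × (Fin (dim e) → I)),
    p.2.2 ∉ Cube.boundary (Fin (dim p.1)) ∧ char p.1 p.2 = x
  boundary : ∀ e (a : G ⧸ stab e) (t : Fin (dim e) → I), t ∈ Cube.boundary (Fin (dim e)) →
    ∃ e' q, dim e' < dim e ∧ char e' q = char e (a, t)
  closed_of : ∀ (n : ℕ∞) (C : Set carrier),
    (∀ x ∈ C, ∃ e q, (dim e : ℕ∞) < n ∧ char e q = x) →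
    (∀ e, (dim e : ℕ∞) < n → IsClosed (char e ⁻¹' C)) → IsClosed C

attribute [instance] GCW.top GCW.act

namespace GCW

variable {G : Type u} [Group G] [TopologicalSpace G]

instance : CoeSort (GCW G) (Type u) := ⟨carrier⟩

variable (X : GCW G)

/-- The union of the closed cells of dimension less than `n`. -/
def skel (n : ℕ∞) : Set X := {x | ∃ e q, (X.dim e : ℕ∞) < n ∧ X.char e q = x}

/-- A subcomplex: a subset which contains every closed cell whose open cell it meets. As the open
cells partition `X`, it is a union of open cells containing their closures. -/
def IsSubcomplex (A : Set X) : Prop :=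
  ∀ e a t, t ∉ Cube.boundary (Fin (X.dim e)) → X.char e (a, t) ∈ A → ∀ q, X.char e q ∈ A

variable {X}

theorem mem_closedCell (x : X) : ∃ e a t, t ∉ Cube.boundary (Fin (X.dim e)) ∧
    X.char e (a, t) = x := by
  obtain ⟨⟨e, a, t⟩, ⟨h1, h2⟩, -⟩ := X.char_bij x
  exact ⟨e, a, t, h1, h2⟩

theorem cell_eq {e e' : X.Cell} {a a' t t'} (h : t ∉ Cube.boundary (Fin (X.dim e)))
    (h' : t' ∉ Cube.boundary (Fin (X.dim e'))) (hx : X.char e (a, t) = X.char e' (a', t')) :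
    (⟨e, a, t⟩ : Σ e, (G ⧸ X.stab e) × (Fin (X.dim e) → I)) = ⟨e', a', t'⟩ :=
  (X.char_bij (X.char e' (a', t'))).unique ⟨h, hx⟩ ⟨h', rfl⟩

/-- A point of an open `n`-cell does not lie in a closed cell of lower dimension. -/
theorem dim_le_of_char_eq {e e' : X.Cell} {a t q}
    (h : t ∉ Cube.boundary (Fin (X.dim e))) (hx : X.char e' q = X.char e (a, t)) :
    X.dim e ≤ X.dim e' := by
  induction hn : X.dim e' using Nat.strong_induction_on generalizing e' with
  | _ n ih =>
    obtain ⟨a', t'⟩ := q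
    by_cases hb : t' ∈ Cube.boundary (Fin (X.dim e'))
    · obtain ⟨e'', q'', hd, hq⟩ := X.boundary e' a' t' hb
      exact (ih _ (hn ▸ hd) (hq.trans hx) rfl).trans (hn ▸ hd.le)
    · have := cell_eq hb h hx
      rw [← hn]
      exact (congrArg (fun p => X.dim p.1) this).ge

theorem isSubcomplex_skel (n : ℕ∞) : X.IsSubcomplex (X.skel n) := by
  rintro e a t ht ⟨e', q', hd, hq⟩ q
  refine ⟨e, q, lt_of_le_of_lt ?_ hd, rfl⟩
  exact_mod_cast dim_le_of_char_eq ht hq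

theorem isSubcomplex_empty : X.IsSubcomplex ∅ := fun _ _ _ _ h => h.elim

theorem isSubcomplex_univ : X.IsSubcomplex Set.univ := fun _ _ _ _ _ _ => trivial

theorem IsSubcomplex.union {A B : Set X} (hA : X.IsSubcomplex A) (hB : X.IsSubcomplex B) :
    X.IsSubcomplex (A ∪ B) := fun e a t ht h q =>
  h.imp (fun h => hA e a t ht h q) (fun h => hB e a t ht h q)

theorem IsSubcomplex.inter {A B : Set X} (hA : X.IsSubcomplex A) (hB : X.IsSubcomplex B) :
    X.IsSubcomplex (A ∩ B) := fun e a t ht h q =>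
  ⟨hA e a t ht h.1 q, hB e a t ht h.2 q⟩

theorem IsSubcomplex.smul_mem {A : Set X} (hA : X.IsSubcomplex A) (g : G) {x : X} (hx : x ∈ A) :
    g • x ∈ A := by
  obtain ⟨e, a, t, ht, rfl⟩ := mem_closedCell x
  rw [← X.char_smul]
  exact hA e a t ht hx _

theorem IsSubcomplex.smul_mem_iff {A : Set X} (hA : X.IsSubcomplex A) (g : G) {x : X} :
    g • x ∈ A ↔ x ∈ A :=
  ⟨fun h => by simpa using hA.smul_mem g⁻¹ h, hA.smul_mem g⟩

/-- A subset of a subcomplex is closed if its preimages in the cells of the subcomplex are. -/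
theorem IsSubcomplex.isClosed_of {B : Set X} (hB : X.IsSubcomplex B) {C : Set X} (hC : C ⊆ B)
    (h : ∀ e, (∀ q, X.char e q ∈ B) → IsClosed (X.char e ⁻¹' C)) : IsClosed C := by
  have key : ∀ e, IsClosed (X.char e ⁻¹' (C ∩ X.skel (X.dim e))) →
      IsClosed (X.char e ⁻¹' C) := by
    intro e he
    by_cases heB : ∀ q, X.char e q ∈ B
    · exact h e heB
    · convert he using 1
      ext ⟨a, t⟩
      refine ⟨fun hx => ⟨hx, ?_⟩, fun hx => hx.1⟩
      have hb : t ∈ Cube.boundary (Fin (X.dim e)) := by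
        by_contra hb
        exact heB (hB e a t hb (hC hx))
      obtain ⟨e', q, hd, hq⟩ := X.boundary e a t hb
      exact ⟨e', q, by exact_mod_cast hd, hq⟩
  have hn : ∀ n : ℕ, IsClosed (C ∩ X.skel n) := by
    intro n
    induction n using Nat.strong_induction_on with
    | _ n ih =>
      refine X.closed_of n _ (fun x hx => hx.2) fun e he => ?_
      have he' : X.dim e < n := by exact_mod_cast he
      convert key e ((ih _ he').preimage (X.continuous_char e)) using 1
      ext q
      exact ⟨fun hx => hx.1, fun hx => ⟨hx, e, q, he, rfl⟩⟩
  refine X.closed_of ⊤ C (fun x _ => ?_) fun e _ => key e ((hn _).preimage (X.continuous_char e))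
  obtain ⟨e, a, t, -, rfl⟩ := mem_closedCell x
  exact ⟨e, _, ENat.natCast_lt_top _, rfl⟩

theorem IsSubcomplex.isClosed {B : Set X} (hB : X.IsSubcomplex B) : IsClosed B :=
  hB.isClosed_of subset_rfl fun e he => by
    have : X.char e ⁻¹' B = Set.univ := Set.eq_univ_of_forall he
    rw [this]
    exact isClosed_univ

theorem isClosed_prod_of {Y : Type*} [TopologicalSpace Y] [LocallyCompactSpace Y] {n : ℕ∞}
    {T : Set (Y × X)} (hT : ∀ p ∈ T, p.2 ∈ X.skel n)
    (h : ∀ e, (X.dim e : ℕ∞) < n → IsClosed (Prod.map id (X.char e) ⁻¹' T)) : IsClosed T := by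
  rw [← isOpen_compl_iff, isOpen_iff_mem_nhds]
  rintro ⟨y, x⟩ hyx
  have hslice : IsClosed {y' : Y | (y', x) ∈ T} := by
    by_cases hx : x ∈ X.skel n
    · obtain ⟨e, q, hd, rfl⟩ := hx
      exact (h e hd).preimage (f := fun y' : Y => (y', q)) (by fun_prop)
    · convert isClosed_empty
      ext y'
      simpa using fun hh => hx (hT _ hh)
  obtain ⟨N, hN, hNT, hNc⟩ := local_compact_nhds (hslice.isOpen_compl.mem_nhds hyx)
  have hD : IsClosed {x' : X | ∃ y' ∈ N, (y', x') ∈ T} := by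
    refine X.closed_of n _ ?_ fun e he => ?_
    · rintro x' ⟨y', -, hh⟩
      exact hT _ hh
    · have : CompactSpace N := isCompact_iff_compactSpace.mp hNc
      have h1 : IsClosed ((fun p : N × ((G ⧸ X.stab e) × (Fin (X.dim e) → I)) =>
          ((p.1 : Y), p.2)) ⁻¹' (Prod.map id (X.char e) ⁻¹' T)) :=
        (h e he).preimage (by fun_prop)
      convert isClosedMap_snd_of_compactSpace _ h1 using 1
      ext q
      simp only [Set.mem_preimage, Set.mem_ofPred_eq, Set.mem_image, Prod.exists, Subtype.exists,
        Prod.map, id]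
      constructor
      · rintro ⟨y', hy', hh⟩
        exact ⟨y', hy', q.1, q.2, hh, rfl⟩
      · rintro ⟨y', hy', a, b, hh, rfl⟩
        exact ⟨y', hy', hh⟩
  refine Filter.mem_of_superset (prod_mem_nhds hN (hD.isOpen_compl.mem_nhds
    (fun ⟨y', hy', hh⟩ => hNT hy' hh))) ?_
  rintro ⟨y', x'⟩ ⟨h1, h2⟩ h3
  exact h2 ⟨y', h1, h3⟩

/-- The elements of `G` act by homeomorphisms. -/
instance [IsTopologicalGroup G] : ContinuousConstSMul G X where
  continuous_const_smul g := by
    refine continuous_iff_isClosed.mpr fun C hC => ?_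
    refine isSubcomplex_univ.isClosed_of (Set.subset_univ _) fun e _ => ?_
    have : X.char e ⁻¹' ((fun x => g • x) ⁻¹' C) =
        (fun q : (G ⧸ X.stab e) × (Fin (X.dim e) → I) => (g • q.1, q.2)) ⁻¹'
          (X.char e ⁻¹' C) := by
      ext ⟨a, t⟩
      simp [X.char_smul]
    rw [this]
    exact (hC.preimage (X.continuous_char e)).preimage (by fun_prop)

/-- If `G` is locally compact, then the action `G × X → X` is jointly continuous. -/
instance [IsTopologicalGroup G] [LocallyCompactSpace G] : ContinuousSMul G X where
  continuous_smul := by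
    refine continuous_iff_isClosed.mpr fun C hC => ?_
    refine isClosed_prod_of (n := ⊤) ?_ fun e _ => ?_
    · rintro ⟨g, x⟩ -
      obtain ⟨e, a, t, -, rfl⟩ := mem_closedCell x
      exact ⟨e, _, ENat.natCast_lt_top _, rfl⟩
    have : Prod.map id (X.char e) ⁻¹' ((fun p : G × X => p.1 • p.2) ⁻¹' C) =
        (fun q : G × ((G ⧸ X.stab e) × (Fin (X.dim e) → I)) => (q.1 • q.2.1, q.2.2)) ⁻¹'
          (X.char e ⁻¹' C) := by
      ext ⟨g, a, t⟩
      simp [X.char_smul]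
    rw [this]
    exact (hC.preimage (X.continuous_char e)).preimage (by fun_prop)

/-- A subcomplex, as a `G`-CW complex. -/
def sub (X : GCW G) (A : Set X) (hA : X.IsSubcomplex A) : GCW G :=
  letI : MulAction G A :=
    { smul := fun g x => ⟨g • x.1, hA.smul_mem g x.2⟩
      one_smul := fun x => Subtype.ext (one_smul G x.1)
      mul_smul := fun g h x => Subtype.ext (mul_smul g h x.1) }
  { carrier := A
    Cell := {e : X.Cell // ∀ q, X.char e q ∈ A}
    dim := fun e => X.dim e.1
    stab := fun e => X.stab e.1
    stab_closed := fun e => X.stab_closed e.1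
    char := fun e q => ⟨X.char e.1 q, e.2 q⟩
    continuous_char := fun e => (X.continuous_char e.1).subtype_mk _
    char_smul := fun e g a t => Subtype.ext (X.char_smul e.1 g a t)
    char_bij := by
      rintro ⟨x, hx⟩
      obtain ⟨e, a, t, ht, rfl⟩ := mem_closedCell x
      refine ⟨⟨⟨e, hA e a t ht hx⟩, a, t⟩, ⟨ht, rfl⟩, ?_⟩
      rintro ⟨⟨e', he'⟩, a', t'⟩ ⟨ht', hx'⟩
      have := cell_eq ht' ht (congrArg Subtype.val hx')
      cases this
      rfl
    boundary := by
      intro e a t ht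
      obtain ⟨e', ⟨a', t'⟩, hd, hq⟩ := X.boundary e.1 a t ht
      -- replace the cell by the one whose open cell contains the point
      obtain ⟨e'', a'', t'', ht'', hq''⟩ := mem_closedCell (X.char e.1 (a, t))
      have hd'' := dim_le_of_char_eq ht'' (hq.trans hq''.symm)
      exact ⟨⟨e'', hA e'' a'' t'' ht'' (hq'' ▸ e.2 _)⟩, (a'', t''), hd''.trans_lt hd,
        Subtype.ext hq''⟩
    closed_of := by
      intro n C hC h
      have hcl : IsClosed (Subtype.val '' C : Set X) := by
        refine (hA.inter (isSubcomplex_skel n)).isClosed_of ?_ fun e he => ?_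
        · rintro _ ⟨x, hx, rfl⟩
          obtain ⟨e, q, hd, rfl⟩ := hC x hx
          exact ⟨e.2 q, e.1, q, hd, rfl⟩
        · by_cases hne : Nonempty ((G ⧸ X.stab e) × (Fin (X.dim e) → I))
          · have hA' : ∀ q, X.char e q ∈ A := fun q => (he q).1
            have hd : (X.dim e : ℕ∞) < n := by
              obtain ⟨e', q', hd, hq'⟩ := (he (((1 : G) : G ⧸ X.stab e), fun _ =>
                ⟨1 / 2, by norm_num, by norm_num⟩)).2
              refine lt_of_le_of_lt ?_ hd
              have hb : (fun _ => ⟨1 / 2, by norm_num, by norm_num⟩ : Fin (X.dim e) → I) ∉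
                  Cube.boundary (Fin (X.dim e)) := by
                rintro ⟨i, hi | hi⟩ <;> · have := congrArg Subtype.val hi; norm_num at this
              exact_mod_cast dim_le_of_char_eq hb hq'
            convert h ⟨e, hA'⟩ hd using 1
            ext q
            simp [hA' q]
          · have : IsEmpty ((G ⧸ X.stab e) × (Fin (X.dim e) → I)) := not_nonempty_iff.mp hne
            convert isClosed_empty
            ext q
            exact this.elim q
      convert hcl.preimage continuous_subtype_val using 1
      exact (Set.preimage_image_eq _ Subtype.val_injective).symm }

end GCW

/-! ### Collapsing a subspace -/

/-- The equivalence relation on `X ⊔ {*}` that identifies `A` with the point `*`. -/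
def collapseSetoid {X : Type u} (A : Set X) : Setoid (X ⊕ Unit) where
  r x y := x = y ∨ (Sum.elim (· ∈ A) (fun _ => True) x ∧ Sum.elim (· ∈ A) (fun _ => True) y)
  iseqv :=
    { refl := fun x => Or.inl rfl
      symm := fun h => h.imp Eq.symm And.symm
      trans := by
        rintro x y z (rfl | h) (rfl | h')
        · exact Or.inl rfl
        · exact Or.inr h'
        · exact Or.inr h
        · exact Or.inr ⟨h.1, h'.2⟩ }

/-- The quotient space `X/A`, pointed at the class of `A`. By convention, `X/∅` is the space `X`
with a disjoint base point. -/
def Collapse {X : Type u} (A : Set X) : Type u := Quotient (collapseSetoid A)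

namespace Collapse

variable {X : Type u} {A : Set X}

/-- The class of a point of `X` in `X/A`. -/
def mk (A : Set X) (x : X) : Collapse A := Quotient.mk (collapseSetoid A) (Sum.inl x)

/-- The base point of `X/A`. -/
def pt (A : Set X) : Collapse A := Quotient.mk (collapseSetoid A) (Sum.inr ())

theorem mk_eq_mk {x y : X} : mk A x = mk A y ↔ x = y ∨ (x ∈ A ∧ y ∈ A) := by
  refine Quotient.eq.trans ?_
  show _ = _ ∨ _ ↔ _
  simp

theorem mk_eq_pt {x : X} : mk A x = pt A ↔ x ∈ A := by
  refine Quotient.eq.trans ?_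
  show _ = _ ∨ _ ↔ _
  simp

theorem cases (p : Collapse A) : p = pt A ∨ ∃ x, x ∉ A ∧ p = mk A x := by
  induction p using Quotient.inductionOn with
  | _ x =>
    rcases x with x | ⟨⟩
    · by_cases hx : x ∈ A
      · exact Or.inl (mk_eq_pt.mpr hx)
      · exact Or.inr ⟨x, hx, rfl⟩
    · exact Or.inl rfl

/-- A map on `X` that is constant with value `b` on `A` induces a map on `X/A`. -/
def lift {Y : Type*} (f : X → Y) (b : Y) (h : ∀ x ∈ A, f x = b) : Collapse A → Y :=
  Quotient.lift (Sum.elim f (fun _ => b)) <| by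
    rintro (x | ⟨⟩) (y | ⟨⟩) (hxy | ⟨h1, h2⟩)
    · rw [hxy]
    · exact (h x h1).trans (h y h2).symm
    · cases hxy
    · exact h x h1
    · cases hxy
    · exact (h y h2).symm
    · rfl
    · rfl

@[simp] theorem lift_mk {Y : Type*} (f : X → Y) (b : Y) (h : ∀ x ∈ A, f x = b) (x : X) :
    lift f b h (mk A x) = f x := rfl

@[simp] theorem lift_pt {Y : Type*} (f : X → Y) (b : Y) (h : ∀ x ∈ A, f x = b) :
    lift f b h (pt A) = b := rfl

variable [TopologicalSpace X]

instance : TopologicalSpace (Collapse A) :=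
  inferInstanceAs (TopologicalSpace (Quotient (collapseSetoid A)))

theorem isClosed_iff {C : Set (Collapse A)} : IsClosed C ↔ IsClosed (mk A ⁻¹' C) := by
  have h : IsQuotientMap (Quotient.mk (collapseSetoid A)) := isQuotientMap_quotient_mk'
  refine (h.isClosed_preimage (s := C)).symm.trans (isClosed_sum_iff.trans ?_)
  exact and_iff_left (isClosed_discrete _)

theorem continuous_mk : Continuous (mk A) :=
  continuous_iff_isClosed.mpr fun _ h => isClosed_iff.mp h

theorem continuous_lift {Y : Type*} [TopologicalSpace Y] {f : X → Y} (b : Y)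
    (h : ∀ x ∈ A, f x = b) (hf : Continuous f) : Continuous (lift f b h) :=
  continuous_iff_isClosed.mpr fun _ hC => isClosed_iff.mpr (hC.preimage hf)

end Collapse

/-- A pointed `G`-CW complex: the base point is fixed by `G` and is a `0`-cell. -/
structure PtGCW (G : Type u) [Group G] [TopologicalSpace G] extends GCW G where
  base : carrier
  smul_base : ∀ g : G, g • base = base
  base_sub : toGCW.IsSubcomplex {base}

namespace GCW

variable {G : Type u} [Group G] [TopologicalSpace G]

/-- The pointed `G`-CW complex `X/A`, for a subcomplex `A` of a `G`-CW complex `X`. Its cells are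
the cells of `X` outside `A`, and the base point. -/
def quot (X : GCW G) (A : Set X) (hA : X.IsSubcomplex A) : PtGCW G :=
  letI : MulAction G (Collapse A) :=
    { smul := fun g => Collapse.lift (fun x => Collapse.mk A (g • x)) (Collapse.pt A)
        (fun x hx => Collapse.mk_eq_pt.mpr (hA.smul_mem g hx))
      one_smul := by
        intro p
        rcases p.cases with rfl | ⟨x, -, rfl⟩
        · rfl
        · exact congrArg (Collapse.mk A) (one_smul G x)
      mul_smul := by
        intro g h p
        rcases p.cases with rfl | ⟨x, -, rfl⟩
        · rfl
        · exact congrArg (Collapse.mk A) (mul_smul g h x) }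
  { carrier := Collapse A
    Cell := {e : X.Cell // ∀ a t, t ∉ Cube.boundary (Fin (X.dim e)) → X.char e (a, t) ∉ A} ⊕ Unit
    dim := Sum.elim (fun e => X.dim e.1) (fun _ => 0)
    stab := Sum.elim (fun e => X.stab e.1) (fun _ => ⊤)
    stab_closed := by
      rintro (e | e)
      · exact X.stab_closed e.1
      · exact isClosed_univ
    char := fun e => match e with
      | Sum.inl e => fun q => Collapse.mk A (X.char e.1 q)
      | Sum.inr _ => fun _ => Collapse.pt A
    continuous_char := by
      rintro (e | e)
      · exact Collapse.continuous_mk.comp (X.continuous_char e.1)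
      · exact continuous_const
    char_smul := by
      rintro (e | e) g a t
      · exact congrArg (Collapse.mk A) (X.char_smul e.1 g a t)
      · rfl
    char_bij := by
      intro p
      rcases p.cases with rfl | ⟨x, hx, rfl⟩
      · refine ⟨⟨Sum.inr (), ((1 : G) : G ⧸ (⊤ : Subgroup G)), Fin.elim0⟩,
          ⟨fun ⟨i, _⟩ => i.elim0, rfl⟩, ?_⟩
        rintro ⟨e | ⟨⟩, a, t⟩ ⟨ht, hp⟩
        · exact (e.2 a t ht (Collapse.mk_eq_pt.mp hp)).elim
        · have h1 : a = ((1 : G) : G ⧸ (⊤ : Subgroup G)) := by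
            have : Subsingleton (G ⧸ (⊤ : Subgroup G)) := QuotientGroup.subsingleton_quotient_top
            exact Subsingleton.elim (α := G ⧸ (⊤ : Subgroup G)) _ _
          have h2 : t = Fin.elim0 := funext fun i => Fin.elim0 i
          rw [h1, h2]
      · obtain ⟨e, a, t, ht, rfl⟩ := mem_closedCell x
        refine ⟨⟨Sum.inl ⟨e, fun a' t' ht' h' => hx (hA e a' t' ht' h' _)⟩, a, t⟩,
          ⟨ht, rfl⟩, ?_⟩
        rintro ⟨⟨e', he'⟩ | ⟨⟩, a', t'⟩ ⟨ht', hp⟩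
        · rcases Collapse.mk_eq_mk.mp hp with h | h
          · cases cell_eq ht' ht h
            rfl
          · exact (hx h.2).elim
        · exact (hx (Collapse.mk_eq_pt.mp hp.symm)).elim
    boundary := by
      rintro (e | e) a t ht
      · obtain ⟨e', q', hd, hq⟩ := X.boundary e.1 a t ht
        by_cases hx : X.char e.1 (a, t) ∈ A
        · refine ⟨Sum.inr (), (((1 : G) : G ⧸ (⊤ : Subgroup G)), Fin.elim0),
            (Nat.zero_le _).trans_lt hd, (Collapse.mk_eq_pt.mpr hx).symm⟩
        · obtain ⟨e'', a'', t'', ht'', hq''⟩ := mem_closedCell (X.char e.1 (a, t))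
          have hd'' := dim_le_of_char_eq ht'' (hq.trans hq''.symm)
          exact ⟨Sum.inl ⟨e'', fun a' t' ht' h' => hx (hq'' ▸ hA e'' a' t' ht' h' _)⟩, (a'', t''),
            hd''.trans_lt hd, congrArg (Collapse.mk A) hq''⟩
      · exact (Fin.elim0 ht.choose)
    closed_of := by
      intro n C hC h
      rw [Collapse.isClosed_iff]
      refine (hA.union (isSubcomplex_skel n)).isClosed_of ?_ fun e he => ?_
      · intro x hx
        obtain ⟨e | e, q, hd, hq⟩ := hC _ hx
        · rcases Collapse.mk_eq_mk.mp hq with rfl | h'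
          · exact Or.inr ⟨e.1, q, hd, rfl⟩
          · exact Or.inl h'.2
        · exact Or.inl (Collapse.mk_eq_pt.mp hq.symm)
      · by_cases hA' : ∀ a t, t ∉ Cube.boundary (Fin (X.dim e)) → X.char e (a, t) ∉ A
        · let t₀ : Fin (X.dim e) → I := fun _ => ⟨1 / 2, by norm_num, by norm_num⟩
          have hb : t₀ ∉ Cube.boundary (Fin (X.dim e)) := by
            rintro ⟨i, hi | hi⟩ <;> · have := congrArg Subtype.val hi; norm_num [t₀] at this
          rcases he (((1 : G) : G ⧸ X.stab e), t₀) with h' | ⟨e', q', hd, hq'⟩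
          · exact (hA' _ _ hb h').elim
          · have hd' : (X.dim e : ℕ∞) < n :=
              lt_of_le_of_lt (by exact_mod_cast dim_le_of_char_eq hb hq') hd
            exact h (Sum.inl ⟨e, hA'⟩) hd'
        · push Not at hA'
          obtain ⟨a, t, ht, hat⟩ := hA'
          by_cases hp : Collapse.pt A ∈ C
          · convert isClosed_univ
            refine Set.eq_univ_of_forall fun q => ?_
            have := Collapse.mk_eq_pt.mpr (hA e a t ht hat q)
            exact (this.symm ▸ hp : Collapse.mk A _ ∈ C)
          · convert isClosed_empty
            refine Set.eq_empty_of_forall_notMem fun q hq => hp ?_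
            have := Collapse.mk_eq_pt.mpr (hA e a t ht hat q)
            exact (this ▸ hq : Collapse.pt A ∈ C)
    base := Collapse.pt A
    smul_base := fun _ => rfl
    base_sub := by
      rintro (e | e) a t ht hp q
      · exact (e.2 a t ht (Collapse.mk_eq_pt.mp hp)).elim
      · rfl }

end GCW

/-! ### Products with finite complexes -/

/-- A finite CW structure on a (Hausdorff) space, with cubes as models of the discs. -/
structure FinCW (K : Type) [TopologicalSpace K] where
  Cell : Type
  [finite : Finite Cell]
  dim : Cell → ℕ
  char : ∀ a, (Fin (dim a) → I) → K
  continuous_char : ∀ a, Continuous (char a)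
  char_bij : ∀ x, ∃! p : (Σ a, (Fin (dim a) → I)),
    p.2 ∉ Cube.boundary (Fin (dim p.1)) ∧ char p.1 p.2 = x
  boundary : ∀ a t, t ∈ Cube.boundary (Fin (dim a)) → ∃ a' t', dim a' < dim a ∧ char a' t' = char a t

attribute [instance] FinCW.finite

/-- A subcomplex of a finite CW complex. -/
def FinCW.IsSubcomplex {K : Type} [TopologicalSpace K] (c : FinCW K) (P : Set K) : Prop :=
  ∀ a t, t ∉ Cube.boundary (Fin (c.dim a)) → c.char a t ∈ P → ∀ t', c.char a t' ∈ P

/-- The interval `I` with the vertices `0`, `1` and one `1`-cell. -/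
def cwI : FinCW I where
  Cell := Option Bool
  dim := fun a => match a with
    | none => 1
    | some _ => 0
  char := fun a => match a with
    | none => fun t => t 0
    | some b => fun _ => cond b 1 0
  continuous_char := by
    rintro (_ | b)
    · exact continuous_apply (0 : Fin 1)
    · exact continuous_const
  char_bij := by
    intro x
    by_cases h0 : x = 0
    · subst h0
      refine ⟨⟨some false, Fin.elim0⟩, ⟨fun ⟨i, _⟩ => i.elim0, rfl⟩, ?_⟩
      rintro ⟨_ | _ | _, t⟩ ⟨ht, hx⟩
      · exact (ht ⟨(0 : Fin 1), Or.inl hx⟩).elim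
      · exact congrArg (Sigma.mk _) (funext fun i => Fin.elim0 i)
      · exact (one_ne_zero hx).elim
    by_cases h1 : x = 1
    · subst h1
      refine ⟨⟨some true, Fin.elim0⟩, ⟨fun ⟨i, _⟩ => i.elim0, rfl⟩, ?_⟩
      rintro ⟨_ | _ | _, t⟩ ⟨ht, hx⟩
      · exact (ht ⟨(0 : Fin 1), Or.inr hx⟩).elim
      · exact (zero_ne_one hx).elim
      · exact congrArg (Sigma.mk _) (funext fun i => Fin.elim0 i)
    · refine ⟨⟨none, fun _ => x⟩, ⟨fun ⟨_, hi⟩ => hi.elim h0 h1, rfl⟩, ?_⟩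
      rintro ⟨_ | _ | _, t⟩ ⟨ht, hx⟩
      · refine congrArg (Sigma.mk none) (funext fun i => ?_)
        rw [Subsingleton.elim (α := Fin 1) i 0]
        exact hx
      · exact (h0 hx.symm).elim
      · exact (h1 hx.symm).elim
  boundary := by
    rintro (_ | b) t ht
    · obtain ⟨i, hi⟩ := ht
      rw [Subsingleton.elim (α := Fin 1) i 0] at hi
      rcases hi with hi | hi
      · exact ⟨some false, Fin.elim0, Nat.zero_lt_one, hi.symm⟩
      · exact ⟨some true, Fin.elim0, Nat.zero_lt_one, hi.symm⟩
    · exact (Fin.elim0 ht.choose)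

/-- The circle `S¹ = I/(0 ∼ 1)`, as `ℝ/ℤ`, with base point `0`. -/
abbrev S1 : Type := AddCircle (1 : ℝ)

/-- The circle with the vertex `0` and one `1`-cell. -/
def cwS1 : FinCW S1 where
  Cell := Bool
  dim := fun a => match a with
    | true => 1
    | false => 0
  char := fun a => match a with
    | true => fun t => ((t 0 : ℝ) : S1)
    | false => fun _ => 0
  continuous_char := by
    rintro (_ | _)
    · exact continuous_const
    · exact (AddCircle.continuous_mk' 1).comp
        (continuous_subtype_val.comp (continuous_apply (0 : Fin 1)))
  char_bij := by
    intro x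
    have hinj : ∀ s t : I, s ≠ 1 → t ≠ 1 → ((s : ℝ) : S1) = ((t : ℝ) : S1) → s = t := by
      intro s t hs ht h
      have hs' : (s : ℝ) ∈ Set.Ico (0 : ℝ) (0 + 1) :=
        ⟨s.2.1, by rw [zero_add]; exact lt_of_le_of_ne s.2.2 fun h => hs (Subtype.ext h)⟩
      have ht' : (t : ℝ) ∈ Set.Ico (0 : ℝ) (0 + 1) :=
        ⟨t.2.1, by rw [zero_add]; exact lt_of_le_of_ne t.2.2 fun h => ht (Subtype.ext h)⟩
      have : Fact ((0 : ℝ) < 1) := ⟨one_pos⟩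
      exact Subtype.ext ((AddCircle.coe_eq_coe_iff_of_mem_Ico hs' ht').mp h)
    have : Fact ((0 : ℝ) < 1) := ⟨one_pos⟩
    obtain ⟨s, hs, rfl⟩ := AddCircle.eq_coe_Ico x
    by_cases h0 : s = 0
    · subst h0
      refine ⟨⟨false, Fin.elim0⟩, ⟨fun ⟨i, _⟩ => i.elim0, rfl⟩, ?_⟩
      rintro ⟨_ | _, t⟩ ⟨ht, hx⟩
      · exact congrArg (Sigma.mk _) (funext fun i => Fin.elim0 i)
      · refine (ht ⟨(0 : Fin 1), Or.inl ?_⟩).elim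
        exact hinj _ 0 (fun h => ht ⟨(0 : Fin 1), Or.inr h⟩) zero_ne_one hx
    · let s' : I := ⟨s, hs.1, hs.2.le⟩
      have hs0 : s' ≠ 0 := fun h => h0 (congrArg Subtype.val h)
      have hs1 : s' ≠ 1 := fun h => hs.2.ne (congrArg Subtype.val h)
      refine ⟨⟨true, fun _ => s'⟩, ⟨fun ⟨_, hi⟩ => hi.elim hs0 hs1, rfl⟩, ?_⟩
      rintro ⟨_ | _, t⟩ ⟨ht, hx⟩
      · exact (hs0 (hinj 0 s' zero_ne_one hs1 hx).symm).elim
      · refine congrArg (Sigma.mk true) (funext fun i => ?_)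
        rw [Subsingleton.elim (α := Fin 1) i 0]
        exact hinj _ s' (fun h => ht ⟨(0 : Fin 1), Or.inr h⟩) hs1 hx
  boundary := by
    rintro (_ | _) t ht
    · exact (Fin.elim0 ht.choose)
    · obtain ⟨i, hi⟩ := ht
      rw [Subsingleton.elim (α := Fin 1) i 0] at hi
      refine ⟨false, Fin.elim0, Nat.zero_lt_one, ?_⟩
      rcases hi with hi | hi
      · show (0 : S1) = ((t 0 : ℝ) : S1)
        rw [hi]
        exact (AddCircle.coe_zero (p := (1 : ℝ))).symm
      · show (0 : S1) = ((t 0 : ℝ) : S1)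
        rw [hi]
        exact (AddCircle.coe_period (1 : ℝ)).symm

namespace GCW

variable {G : Type u} [Group G] [TopologicalSpace G]

/-- The product `K × X` of a finite CW complex `K`, with the trivial action of `G`, and a `G`-CW
complex `X`, with the product topology and with the products of cells as cells. -/
def prod {K : Type} [TopologicalSpace K] [T2Space K] (c : FinCW K) (X : GCW G) : GCW G :=
  letI : MulAction G (K × X) :=
    { smul := fun g p => (p.1, g • p.2)
      one_smul := fun p => Prod.ext rfl (one_smul G p.2)
      mul_smul := fun g h p => Prod.ext rfl (mul_smul g h p.2) }
  have hbd : ∀ {k n : ℕ} (t : Fin (k + n) → I), t ∈ Cube.boundary (Fin (k + n)) ↔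
      (fun i => t (Fin.castAdd n i)) ∈ Cube.boundary (Fin k) ∨
        (fun i => t (Fin.natAdd k i)) ∈ Cube.boundary (Fin n) := by
    intro k n t
    constructor
    · rintro ⟨i, hi⟩
      induction i using Fin.addCases with
      | left i => exact Or.inl ⟨i, hi⟩
      | right i => exact Or.inr ⟨i, hi⟩
    · rintro (⟨i, hi⟩ | ⟨i, hi⟩)
      · exact ⟨_, hi⟩
      · exact ⟨_, hi⟩
  have happ : ∀ {k n : ℕ} (t : Fin (k + n) → I),
      Fin.append (fun i => t (Fin.castAdd n i)) (fun i => t (Fin.natAdd k i)) = t := by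
    intro k n t
    exact Fin.append_castAdd_natAdd
  { carrier := K × X
    Cell := c.Cell × X.Cell
    dim := fun e => c.dim e.1 + X.dim e.2
    stab := fun e => X.stab e.2
    stab_closed := fun e => X.stab_closed e.2
    char := fun e q => (c.char e.1 (fun i => q.2 (Fin.castAdd _ i)),
      X.char e.2 (q.1, fun i => q.2 (Fin.natAdd _ i)))
    continuous_char := fun e => by
      refine ((c.continuous_char e.1).comp ?_).prodMk ((X.continuous_char e.2).comp ?_)
      · fun_prop
      · fun_prop
    char_smul := fun e g a t => Prod.ext rfl (X.char_smul e.2 g a _)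
    char_bij := by
      rintro ⟨y, x⟩
      obtain ⟨⟨b, s⟩, ⟨hs, rfl⟩, hu⟩ := c.char_bij y
      obtain ⟨e, a, t, ht, rfl⟩ := mem_closedCell x
      refine ⟨⟨(b, e), a, Fin.append s t⟩, ⟨?_, ?_⟩, ?_⟩
      · rw [hbd]
        simp only [Fin.append_left, Fin.append_right]
        exact fun h => h.elim hs ht
      · simp only [Fin.append_left, Fin.append_right]
      · rintro ⟨⟨b', e'⟩, a', t'⟩ ⟨ht', hx'⟩
        rw [hbd, not_or] at ht'
        have h1 := hu ⟨b', _⟩ ⟨ht'.1, congrArg Prod.fst hx'⟩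
        have h2 := cell_eq ht'.2 ht (congrArg Prod.snd hx')
        cases h1
        cases h2
        simp only [happ]
    boundary := by
      rintro ⟨b, e⟩ a t ht
      rcases (hbd t).mp ht with h | h
      · obtain ⟨b', s', hd, hq⟩ := c.boundary _ _ h
        refine ⟨(b', e), (a, Fin.append s' (fun i => t (Fin.natAdd _ i))), Nat.add_lt_add_right hd _,
          ?_⟩
        simp only [Fin.append_left, Fin.append_right, hq]
      · obtain ⟨e', ⟨a', t'⟩, hd, hq⟩ := X.boundary e a _ h
        refine ⟨(b, e'), (a', Fin.append (fun i => t (Fin.castAdd _ i)) t'),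
          Nat.add_lt_add_left hd _, ?_⟩
        simp only [Fin.append_left, Fin.append_right, hq]
    closed_of := by
      intro n C hC h
      let T : ∀ b : c.Cell, Set ((Fin (c.dim b) → I) × X) := fun b =>
        {p | p.2 ∈ X.skel (n - c.dim b) ∧ (c.char b p.1, p.2) ∈ C}
      have hT : ∀ b, IsClosed (T b) := by
        intro b
        refine isClosed_prod_of (fun p hp => hp.1) fun e he => ?_
        have he' : (((c.dim b + X.dim e : ℕ) : ℕ∞)) < n := by
          push_cast
          exact lt_tsub_iff_left.mp he
        have hcl := h (b, e) he'
        convert hcl.preimage (f := fun p : (Fin (c.dim b) → I) ×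
          ((G ⧸ X.stab e) × (Fin (X.dim e) → I)) => (p.2.1, Fin.append p.1 p.2.2)) ?_ using 1
        · ext ⟨s, a, t⟩
          simp only [Set.mem_preimage, Prod.map, id, T, Set.mem_ofPred_eq, Fin.append_left,
            Fin.append_right]
          exact and_iff_right ⟨e, _, he, rfl⟩
        · refine (by fun_prop : Continuous _).prodMk (continuous_pi fun i => ?_)
          induction i using Fin.addCases with
          | left i => simp only [Fin.append_left]; fun_prop
          | right i => simp only [Fin.append_right]; fun_prop
      have hcover : C = ⋃ b, Prod.map (c.char b) id '' T b := by
        ext p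
        simp only [Set.mem_iUnion]
        constructor
        · intro hp
          obtain ⟨⟨b, e⟩, q, hd, rfl⟩ := hC p hp
          refine ⟨b, (_, _), ⟨⟨e, _, ?_, rfl⟩, hp⟩, rfl⟩
          rw [lt_tsub_iff_left]
          exact_mod_cast hd
        · rintro ⟨b, ⟨s, x⟩, hx, rfl⟩
          exact hx.2
      rw [hcover]
      exact isClosed_iUnion_of_finite fun b =>
        (((c.continuous_char b).isProperMap).prodMap isProperMap_id).isClosedMap _ (hT b) }

theorem isSubcomplex_prod {K : Type} [TopologicalSpace K] [T2Space K] {c : FinCW K} {X : GCW G}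
    {P : Set K} {A : Set X} (hP : c.IsSubcomplex P) (hA : X.IsSubcomplex A) :
    (X.prod c).IsSubcomplex (P ×ˢ A : Set (K × X)) := by
  rintro ⟨b, e⟩ a t ht ⟨h1, h2⟩ q
  refine ⟨hP b _ (fun h => ht ?_) h1 _, hA e a _ (fun h => ht ?_) h2 _⟩
  · obtain ⟨i, hi⟩ := h
    exact ⟨_, hi⟩
  · obtain ⟨i, hi⟩ := h
    exact ⟨_, hi⟩

end GCW

theorem FinCW.isSubcomplex_univ {K : Type} [TopologicalSpace K] (c : FinCW K) :
    c.IsSubcomplex Set.univ := fun _ _ _ _ _ => trivial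

theorem cwI_zero : cwI.IsSubcomplex {0} := by
  rintro (_ | _ | _) t ht h t'
  · exact (ht ⟨(0 : Fin 1), Or.inl h⟩).elim
  · exact h
  · exact h

theorem cwI_one : cwI.IsSubcomplex {1} := by
  rintro (_ | _ | _) t ht h t'
  · exact (ht ⟨(0 : Fin 1), Or.inr h⟩).elim
  · exact h
  · exact h

theorem cwS1_zero : cwS1.IsSubcomplex {0} := by
  intro a t ht h t'
  have h0 : cwS1.char false Fin.elim0 = 0 := rfl
  have := (cwS1.char_bij 0).unique (y₁ := ⟨a, t⟩) (y₂ := ⟨false, Fin.elim0⟩) ⟨ht, h⟩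
    ⟨fun ⟨i, _⟩ => i.elim0, rfl⟩
  cases this
  rfl

/-! ### Maps and homotopies -/

variable {G : Type u} [Group G] [TopologicalSpace G]

/-- A (continuous) `G`-map between `G`-CW complexes; it need not be cellular. -/
structure GMap (X Y : GCW G) where
  toFun : X → Y
  continuous : Continuous toFun
  map_smul : ∀ (g : G) (x : X), toFun (g • x) = g • toFun x

/-- The identity `G`-map. -/
def GMap.id (X : GCW G) : GMap X X := ⟨fun x => x, continuous_id, fun _ _ => rfl⟩

/-- A (continuous) pointed `G`-map between pointed `G`-CW complexes; it need not be cellular. -/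
structure PtMap (X Y : PtGCW G) extends GMap X.toGCW Y.toGCW where
  map_base : toFun X.base = Y.base

namespace PtMap

/-- The identity map. -/
def id (X : PtGCW G) : PtMap X X := ⟨GMap.id X.toGCW, rfl⟩

/-- The composite `g ∘ f`. -/
def comp {X Y Z : PtGCW G} (g : PtMap Y Z) (f : PtMap X Y) : PtMap X Z where
  toFun := g.toFun ∘ f.toFun
  continuous := g.continuous.comp f.continuous
  map_smul a x := by simp [f.map_smul, g.map_smul]
  map_base := by simp [f.map_base, g.map_base]

/-- Pointed `G`-maps are homotopic if they are joined by a homotopy through pointed `G`-maps. -/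
def Homotopic {X Y : PtGCW G} (f₀ f₁ : PtMap X Y) : Prop :=
  ∃ h : I × X.carrier → Y.carrier, Continuous h ∧
    (∀ (t : I) (g : G) (x : X.carrier), h (t, g • x) = g • h (t, x)) ∧
    (∀ t : I, h (t, X.base) = Y.base) ∧
    (∀ x, h (0, x) = f₀.toFun x) ∧ (∀ x, h (1, x) = f₁.toFun x)

end PtMap

/-! ### Subcomplexes, quotients and smash products -/

/-- The one-point `G`-CW complex. -/
def point (G : Type u) [Group G] [TopologicalSpace G] : PtGCW G :=
  letI : MulAction G PUnit.{u + 1} :=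
    { smul := fun _ x => x
      one_smul := fun _ => rfl
      mul_smul := fun _ _ _ => rfl }
  { carrier := PUnit.{u + 1}
    Cell := PUnit.{u + 1}
    dim := fun _ => 0
    stab := fun _ => ⊤
    stab_closed := fun _ => isClosed_univ
    char := fun _ _ => PUnit.unit
    continuous_char := fun _ => continuous_const
    char_smul := fun _ _ _ _ => rfl
    char_bij := by
      intro x
      refine ⟨⟨PUnit.unit, ((1 : G) : G ⧸ (⊤ : Subgroup G)), Fin.elim0⟩,
        ⟨fun ⟨i, _⟩ => i.elim0, rfl⟩, ?_⟩
      rintro ⟨⟨⟩, a, t⟩ -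
      have h1 : a = ((1 : G) : G ⧸ (⊤ : Subgroup G)) := by
        have : Subsingleton (G ⧸ (⊤ : Subgroup G)) := QuotientGroup.subsingleton_quotient_top
        exact Subsingleton.elim (α := G ⧸ (⊤ : Subgroup G)) _ _
      have h2 : t = Fin.elim0 := funext fun i => Fin.elim0 i
      rw [h1, h2]
    boundary := fun _ _ _ ht => Fin.elim0 ht.choose
    closed_of := fun _ _ _ _ => isClosed_discrete _
    base := PUnit.unit
    smul_base := fun _ => rfl
    base_sub := fun _ _ _ _ _ _ => rfl }

namespace GCW

theorem IsSubcomplex.preimage_sub {X : GCW G} {A B : Set X} (hA : X.IsSubcomplex A)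
    (hB : X.IsSubcomplex B) : (X.sub A hA).IsSubcomplex (Subtype.val ⁻¹' B : Set A) :=
  fun e a t ht h q => hB e.1 a t ht h (q : (G ⧸ X.stab e.1) × (Fin (X.dim e.1) → I))

/-- The inclusion of a subcomplex. -/
def incl (X : GCW G) (A : Set X) (hA : X.IsSubcomplex A) : GMap (X.sub A hA) X where
  toFun := Subtype.val
  continuous := continuous_subtype_val
  map_smul _ _ := rfl

/-- The constant map `X → *`. -/
def toPoint (X : GCW G) : GMap X (point G).toGCW where
  toFun _ := PUnit.unit
  continuous := continuous_const
  map_smul _ _ := rfl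

/-- The map `X/A → Y/B` induced by a map of pairs `(X, A) → (Y, B)`. -/
def quotMap {X Y : GCW G} {A : Set X} {B : Set Y} (hA : X.IsSubcomplex A) (hB : Y.IsSubcomplex B)
    (f : GMap X Y) (h : ∀ x ∈ A, f.toFun x ∈ B) : PtMap (X.quot A hA) (Y.quot B hB) where
  toFun := Collapse.lift (fun x => Collapse.mk B (f.toFun x)) (Collapse.pt B)
    (fun x hx => Collapse.mk_eq_pt.mpr (h x hx))
  continuous := Collapse.continuous_lift _ _ (Collapse.continuous_mk.comp f.continuous)
  map_smul g p := by
    rcases Collapse.cases p with rfl | ⟨x, -, rfl⟩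
    · rfl
    · exact congrArg (Collapse.mk B) (f.map_smul g x)
  map_base := rfl

/-- The complex `X₊ = X/∅`, which is `X` with a disjoint base point. -/
def plus (X : GCW G) : PtGCW G := X.quot ∅ isSubcomplex_empty

/-- The map `X₊ → Y₊` induced by a `G`-map. -/
def plusMap {X Y : GCW G} (f : GMap X Y) : PtMap X.plus Y.plus :=
  quotMap isSubcomplex_empty isSubcomplex_empty f (fun _ h => h.elim)

end GCW

namespace PtGCW

/-- A subcomplex containing the base point, as a pointed `G`-CW complex. -/
def sub (X : PtGCW G) (A : Set X.carrier) (hA : X.IsSubcomplex A) (hb : X.base ∈ A) : PtGCW G where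
  toGCW := X.toGCW.sub A hA
  base := (⟨X.base, hb⟩ : A)
  smul_base g := Subtype.ext (X.smul_base g)
  base_sub := by
    have : (Subtype.val ⁻¹' {X.base} : Set A) = {⟨X.base, hb⟩} :=
      Set.ext fun x => (Subtype.ext_iff (a1 := x) (a2 := ⟨X.base, hb⟩)).symm
    exact this ▸ hA.preimage_sub X.base_sub

/-- The inclusion of a subcomplex containing the base point. -/
def incl (X : PtGCW G) (A : Set X.carrier) (hA : X.IsSubcomplex A) (hb : X.base ∈ A) :
    PtMap (X.sub A hA hb) X where
  toGMap := X.toGCW.incl A hA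
  map_base := rfl

/-- The collapse map `X → X/A`, for a subcomplex `A` containing the base point. -/
def collapse (X : PtGCW G) (A : Set X.carrier) (hA : X.IsSubcomplex A) (hb : X.base ∈ A) :
    PtMap X (X.toGCW.quot A hA) where
  toFun := Collapse.mk A
  continuous := Collapse.continuous_mk
  map_smul _ _ := rfl
  map_base := Collapse.mk_eq_pt.mpr hb

/-- The product `S¹ × X`, with the base point `(0, *)`. -/
def circleProd (X : PtGCW G) : PtGCW G where
  toGCW := X.toGCW.prod cwS1
  base := ((0, X.base) : S1 × X.carrier)
  smul_base g := Prod.ext rfl (X.smul_base g)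
  base_sub := by
    have h := GCW.isSubcomplex_prod cwS1_zero X.base_sub
    rwa [Set.singleton_prod_singleton] at h

/-- The wedge `S¹ ∨ X`, as a subset of `S¹ × X`. -/
def wedge (X : PtGCW G) : Set (S1 × X.carrier) := {0} ×ˢ Set.univ ∪ Set.univ ×ˢ {X.base}

theorem wedge_sub (X : PtGCW G) : (X.toGCW.prod cwS1).IsSubcomplex X.wedge :=
  (GCW.isSubcomplex_prod cwS1_zero GCW.isSubcomplex_univ).union
    (GCW.isSubcomplex_prod cwS1.isSubcomplex_univ X.base_sub)

/-- The reduced suspension `S¹ ∧ X = (S¹ × X)/(S¹ ∨ X)`. -/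
def susp (X : PtGCW G) : PtGCW G := (X.toGCW.prod cwS1).quot X.wedge X.wedge_sub

/-- The quotient map `S¹ × X → S¹ ∧ X`. -/
def toSusp (X : PtGCW G) : PtMap X.circleProd X.susp where
  toFun := Collapse.mk X.wedge
  continuous := Collapse.continuous_mk
  map_smul _ _ := rfl
  map_base := Collapse.mk_eq_pt.mpr (Or.inl ⟨rfl, trivial⟩)

/-- The circle, as a pointed `G`-CW complex with the trivial action. -/
def circle (G : Type u) [Group G] [TopologicalSpace G] : PtGCW G := (point G).circleProd

/-- The projection `S¹ × X → S¹`. -/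
def projCircle (X : PtGCW G) : PtMap X.circleProd (circle G) where
  toFun := fun p : S1 × X.carrier => ((p.1, PUnit.unit) : S1 × PUnit.{u + 1})
  continuous := continuous_fst.prodMk continuous_const
  map_smul _ _ := rfl
  map_base := rfl

/-- The projection `S¹ × X → X`. -/
def proj (X : PtGCW G) : PtMap X.circleProd X where
  toFun := fun p : S1 × X.carrier => p.2
  continuous := continuous_snd
  map_smul _ _ := rfl
  map_base := rfl

end PtGCW

/-- The suspension `S¹ ∧ f` of a pointed `G`-map. -/
def PtMap.susp {X Y : PtGCW G} (f : PtMap X Y) : PtMap X.susp Y.susp :=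
  GCW.quotMap X.wedge_sub Y.wedge_sub
    { toFun := (fun p => (p.1, f.toFun p.2) : S1 × X.carrier → S1 × Y.carrier)
      continuous := continuous_fst.prodMk (f.continuous.comp continuous_snd)
      map_smul := fun g p => Prod.ext rfl (f.map_smul g p.2) }
    (fun _ hp => hp.imp (fun h => h) fun h => ⟨trivial, (congrArg f.toFun h.2).trans f.map_base⟩)

/-! ### Cohomology theories -/

/-- A multiplicative `ℤ`-graded `G`-equivariant cohomology theory: a contravariant homotopy functor
`Ẽ* = ⨁ₙ Ẽⁿ` from pointed `G`-CW complexes to (associative, not necessarily unital) graded rings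
that are commutative in the graded sense, which is exact on cofibre sequences `A → X → X/A`; for
which the unreduced rings `E*(X) = Ẽ*(X₊)` have a unit, the pullback of a class
`1 ∈ E⁰(*) = Ẽ⁰(S⁰)`; and which is equipped with a class `es ∈ Ẽ¹(S¹)` such that the cross product
`x ↦ es × x` is a natural isomorphism `Ẽⁿ(X) → Ẽⁿ⁺¹(S¹ ∧ X)`. Here `es × x` is the class in
`Ẽ(S¹ ∧ X)` whose pullback to `S¹ × X` is the product of the pullbacks of `es` and `x`. -/
structure MulCohTheory (G : Type u) [Group G] [TopologicalSpace G] where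
  obj : PtGCW G → Type v
  [ring : ∀ X, NonUnitalRing (obj X)]
  gr : ∀ X, ℤ → AddSubgroup (obj X)
  isInternal : ∀ X, DirectSum.IsInternal (gr X)
  mul_mem : ∀ {X m n} {x y : obj X}, x ∈ gr X m → y ∈ gr X n → x * y ∈ gr X (m + n)
  graded_comm : ∀ {X m n} {x y : obj X}, x ∈ gr X m → y ∈ gr X n →
    x * y = (m * n).negOnePow • (y * x)
  map : ∀ {X Y : PtGCW G}, PtMap X Y → (obj Y →ₙ+* obj X)
  map_mem : ∀ {X Y : PtGCW G} (f : PtMap X Y) {n} {y : obj Y}, y ∈ gr Y n → map f y ∈ gr X n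
  map_id : ∀ (X : PtGCW G) (x : obj X), map (PtMap.id X) x = x
  map_comp : ∀ {X Y Z : PtGCW G} (g : PtMap Y Z) (f : PtMap X Y) (z : obj Z),
    map (g.comp f) z = map f (map g z)
  homotopy : ∀ {X Y : PtGCW G} (f₀ f₁ : PtMap X Y), f₀.Homotopic f₁ → map f₀ = map f₁
  exact : ∀ (X : PtGCW G) (A : Set X.carrier) (hA : X.IsSubcomplex A) (hb : X.base ∈ A),
    Function.Exact (map (X.collapse A hA hb)) (map (X.incl A hA hb))
  one : obj (point G).plus
  one_mem : one ∈ gr _ 0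
  one_mul : ∀ (X : GCW G) (x : obj X.plus), map (GCW.plusMap X.toPoint) one * x = x
  es : obj (PtGCW.circle G)
  es_mem : es ∈ gr _ 1
  suspIso : ∀ X : PtGCW G, obj X ≃+ obj X.susp
  suspIso_mem : ∀ {X : PtGCW G} {n} {x : obj X}, x ∈ gr X n → suspIso X x ∈ gr X.susp (n + 1)
  suspIso_natural : ∀ {X Y : PtGCW G} (f : PtMap X Y) (y : obj Y), suspIso X (map f y) = map f.susp (suspIso Y y)
  suspIso_eq_cross : ∀ (X : PtGCW G) (x : obj X),
    map X.toSusp (suspIso X x) = map X.projCircle es * map X.proj x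

attribute [instance] MulCohTheory.ring

/-! ### Connecting maps -/

namespace GCW

variable {X : GCW G} {A B : Set X}

/-- The subcomplex `{1} × A ∪ I × B` of `I × X`. -/
def coneSet (A B : Set X) : Set (I × X) := {1} ×ˢ A ∪ Set.univ ×ˢ B

theorem coneSet_sub (hA : X.IsSubcomplex A) (hB : X.IsSubcomplex B) :
    (X.prod cwI).IsSubcomplex (coneSet A B) :=
  (isSubcomplex_prod cwI_one hA).union (isSubcomplex_prod cwI.isSubcomplex_univ hB)

/-- For subcomplexes `B ⊆ A` of `X`, the mapping cone `A ∪ CB = A₊ ∪ C(B₊)`, as the quotient of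
`{1} × A ∪ I × B` by `{0} × B`. -/
def cone (hA : X.IsSubcomplex A) (hB : X.IsSubcomplex B) : PtGCW G :=
  ((X.prod cwI).sub (coneSet A B) (coneSet_sub hA hB)).quot
    (Subtype.val ⁻¹' ({0} ×ˢ Set.univ : Set (I × X)))
    ((coneSet_sub hA hB).preimage_sub (isSubcomplex_prod cwI_zero isSubcomplex_univ))

/-- For subcomplexes `B ⊆ A` of `X`, the pointed complex `A/B`. -/
def subquot (hA : X.IsSubcomplex A) (hB : X.IsSubcomplex B) : PtGCW G :=
  (X.sub A hA).quot (Subtype.val ⁻¹' B : Set A) (hA.preimage_sub hB)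

/-- The map `A ∪ CB → A/B` that collapses the cone `CB`. -/
def coneToQuot (hA : X.IsSubcomplex A) (hB : X.IsSubcomplex B) (hBA : B ⊆ A) :
    PtMap (cone hA hB) (subquot hA hB) :=
  quotMap _ _
    { toFun := (fun p => ⟨p.1.2, p.2.elim (fun h => h.2) fun h => hBA h.2⟩ : coneSet A B → A)
      continuous := (continuous_snd.comp continuous_subtype_val).subtype_mk _
      map_smul := fun _ _ => rfl }
    (fun p hp => p.2.elim (fun h => (zero_ne_one (hp.1.symm.trans h.1)).elim) fun h => h.2)

open Classical in
/-- The map `{1} × A ∪ I × B → S¹ ∧ B₊` with `(t, b) ↦ t ∧ b` that sends `{1} × A` to the base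
point. -/
noncomputable def coneToSuspFun (hB : X.IsSubcomplex B) (p : coneSet A B) :
    (X.sub B hB).plus.susp.carrier :=
  if h : p.1.2 ∈ B then
    Collapse.mk (X.sub B hB).plus.wedge (((p.1.1 : ℝ) : S1), Collapse.mk ∅ (⟨p.1.2, h⟩ : B))
  else (X.sub B hB).plus.susp.base

theorem coneToSuspFun_of_mem (hB : X.IsSubcomplex B) {p : coneSet A B} (h : p.1.2 ∈ B) :
    coneToSuspFun hB p =
      Collapse.mk (X.sub B hB).plus.wedge
        (((p.1.1 : ℝ) : S1), Collapse.mk ∅ (⟨p.1.2, h⟩ : B)) := dif_pos h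

theorem coneToSuspFun_of_end (hB : X.IsSubcomplex B) {p : coneSet A B}
    (h : ((p.1.1 : ℝ) : S1) = 0) :
    coneToSuspFun hB p = (X.sub B hB).plus.susp.base := by
  by_cases hp : p.1.2 ∈ B
  · rw [coneToSuspFun_of_mem hB hp]
    exact Collapse.mk_eq_pt.mpr (Or.inl ⟨h, trivial⟩)
  · exact dif_neg hp

theorem continuous_coneToSuspFun (hA : X.IsSubcomplex A) (hB : X.IsSubcomplex B) :
    Continuous (coneToSuspFun hB : coneSet A B → _) := by
  have h1 : IsClosed {p : coneSet A B | p.1.1 = 1 ∧ p.1.2 ∈ A} :=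
    (isClosed_singleton.preimage (continuous_fst.comp continuous_subtype_val)).inter
      (hA.isClosed.preimage (continuous_snd.comp continuous_subtype_val))
  have h2 : IsClosed {p : coneSet A B | p.1.2 ∈ B} :=
    hB.isClosed.preimage (continuous_snd.comp continuous_subtype_val)
  rw [← continuousOn_univ]
  have hu : (Set.univ : Set (coneSet A B)) =
      {p | p.1.1 = 1 ∧ p.1.2 ∈ A} ∪ {p | p.1.2 ∈ B} := by
    ext p
    exact ⟨fun _ => p.2.imp (fun h => h) fun h => h.2, fun _ => trivial⟩
  rw [hu]
  refine ContinuousOn.union_of_isClosed ?_ ?_ h1 h2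
  · refine (continuousOn_const (c := (X.sub B hB).plus.susp.base)).congr fun p hp => ?_
    refine coneToSuspFun_of_end hB ?_
    rw [hp.1]
    exact AddCircle.coe_period (1 : ℝ)
  · rw [continuousOn_iff_continuous_domRestrict]
    have : Set.domRestrict {p : coneSet A B | p.1.2 ∈ B} (coneToSuspFun hB) =
        fun p => Collapse.mk (X.sub B hB).plus.wedge
          (((p.1.1.1 : ℝ) : S1), Collapse.mk ∅ (⟨p.1.1.2, p.2⟩ : B)) :=
      funext fun p => coneToSuspFun_of_mem hB p.2
    rw [this]
    refine Collapse.continuous_mk.comp (Continuous.prodMk ?_ ?_)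
    · exact (AddCircle.continuous_mk' 1).comp (by fun_prop)
    · exact Collapse.continuous_mk.comp (Continuous.subtype_mk (by fun_prop) _)

/-- The map `A ∪ CB → S¹ ∧ B₊` that collapses `A`. -/
noncomputable def coneToSusp (hA : X.IsSubcomplex A) (hB : X.IsSubcomplex B) :
    PtMap (cone hA hB) (X.sub B hB).plus.susp where
  toFun := Collapse.lift (coneToSuspFun hB) (X.sub B hB).plus.susp.base
    (fun p hp => coneToSuspFun_of_end hB (by rw [hp.1]; exact AddCircle.coe_zero (p := (1 : ℝ))))
  continuous := Collapse.continuous_lift _ _ (continuous_coneToSuspFun hA hB)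
  map_smul g p := by
    rcases Collapse.cases p with rfl | ⟨⟨⟨t, x⟩, hx⟩, -, rfl⟩
    · rfl
    · by_cases h : x ∈ B
      · refine (coneToSuspFun_of_mem hB (p := ⟨(t, g • x), (coneSet_sub hA hB).smul_mem g hx⟩)
          (hB.smul_mem g h)).trans ?_
        exact (congrArg (g • ·) (coneToSuspFun_of_mem hB (p := ⟨(t, x), hx⟩) h)).symm
      · refine (dif_neg fun h' => h ((hB.smul_mem_iff g).mp h') :
          coneToSuspFun hB ⟨(t, g • x), (coneSet_sub hA hB).smul_mem g hx⟩ = _).trans ?_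
        exact (congrArg (g • ·) (dif_neg h : coneToSuspFun hB ⟨(t, x), hx⟩ = _)).symm
  map_base := rfl

end GCW

namespace MulCohTheory

variable (E : MulCohTheory.{u, v} G) {X : GCW G}

/-- The unreduced cohomology `E*(X) = Ẽ*(X₊)`. -/
abbrev H (X : GCW G) : Type v := E.obj X.plus

/-- The restriction `E*(X) → E*(A)` to a subcomplex. -/
def res {A : Set X} (hA : X.IsSubcomplex A) : E.H X →ₙ+* E.H (X.sub A hA) :=
  E.map (GCW.plusMap (X.incl A hA))

/-- For subcomplexes `B ⊆ A`, the graph of the connecting map `E*(B) → E*⁺¹(A, B) = Ẽ*⁺¹(A/B)` in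
the long exact sequence of the pair `(A, B)`. This map is the suspension `Ẽ*(B₊) → Ẽ*⁺¹(S¹ ∧ B₊)`,
followed by the map that the zigzag `A/B ← A ∪ CB → S¹ ∧ B₊` induces, whose arrow to the left is an
equivalence. -/
def IsCoboundary {A B : Set X} (hA : X.IsSubcomplex A) (hB : X.IsSubcomplex B) (hBA : B ⊆ A)
    (b : E.H (X.sub B hB)) (y : E.obj (GCW.subquot hA hB)) : Prop :=
  E.map (GCW.coneToQuot hA hB hBA) y = E.map (GCW.coneToSusp hA hB) (E.suspIso _ b)

/-- The graph of the connecting map `E*(W) → E*⁺¹(X)`, with `W = U ∩ V`, in the Mayer-Vietoris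
sequence of a triad `(X; U, V)`. This map is the composite
`E*(W) → E*⁺¹(V, W) ← E*⁺¹(X, U) → E*⁺¹(X)` of the connecting map of the pair `(V, W)`, the inverse
of the excision isomorphism induced by `V/W → X/U`, and the map induced by `X₊ → X/U`. -/
def IsMayerVietoris {U V : Set X} (hU : X.IsSubcomplex U) (hV : X.IsSubcomplex V)
    (w : E.H (X.sub (U ∩ V) (hU.inter hV))) (x : E.H X) : Prop :=
  ∃ z : E.obj (X.quot U hU),
    E.IsCoboundary hV (hU.inter hV) Set.inter_subset_right w
      (E.map (GCW.quotMap (hV.preimage_sub (hU.inter hV)) hU (X.incl V hV) fun _ h => h.1) z) ∧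
    E.map (GCW.quotMap GCW.isSubcomplex_empty hU (GMap.id X) fun _ h => h.elim) z = x

end MulCohTheory

end EquivCoh

/-! Write `W` for `U ∩ V`. The connecting map is the suspension isomorphism `E*(W) → Ẽ*⁺¹(S¹ ∧ W₊)`
followed by pullback along `X₊ → X/U → S¹ ∧ W₊`. The second map comes from inverting excision and
the collapse of the cone. The inverse of the collapse is written down explicitly, using an
equivariant retraction `R` of `I × X` onto `{1} × X ∪ I × U`; this homotopy extension property is
proved cell by cell.

The module property is proved on the auxiliary complex `C = {0} × X ∪ S¹ × W`. The bottom `x ↦ R(0,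
x)` of the retraction, with its height read modulo `0 ∼ 1`, gives a map `X → C`. Its composite with
the collapse `C₊ → S¹ ∧ W₊` is exactly the map defining `δ`, and its composite with the projection
`C → X` is homotopic to the identity. So it is enough to show on `C` that the pullback of `e × (w ·
j*x)` equals the pullback of `e × w` times that of `x`.

Both classes vanish on `{0} × X`. On `S¹ × W` they agree by associativity, since the cross product
there is a product of pullbacks. A class vanishing on both pieces is zero, because `S¹ × W` retracts
onto the intersection `{0} × W` (`eq_zero_of_res_eq_zero`). This is `map_circlesToSusp_mul`, and
pulling back to `X` gives `mayerVietoris_mul_res`.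

The rest is formal. Graded commutativity gives the left-handed formula with its sign. Since `W ⊆ U`,
the composite `W₊ → X₊ → X/U` is constant, so `j*δ = 0` and `δ(w) δ(w') = δ(w · j*δ(w')) = 0`. -/

namespace EquivCoh

variable {G : Type u} [Group G] [TopologicalSpace G]

/-! ### The homotopy extension property -/

/-! ### Radial retraction of the cylinder over a cube. -/

section CubeRetraction

variable {n : ℕ}

/-- The vector from the centre of the cube `[0, 1]ⁿ` to a point, in units of half an edge. -/
def cubeVec (s : Fin n → I) : Fin n → ℝ := fun i => 2 * (s i : ℝ) - 1

/-- The factor by which the radial projection from the point above the centre of `{0} × Iⁿ` at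
height `-1` contracts. -/
noncomputable def cubeGauge (p : I × (Fin n → I)) : ℝ := max ((1 + (p.1 : ℝ)) / 2) ‖cubeVec p.2‖

theorem continuous_cubeVec : Continuous (cubeVec : (Fin n → I) → _) := by
  unfold cubeVec
  fun_prop

theorem continuous_cubeGauge : Continuous (cubeGauge : I × (Fin n → I) → ℝ) := by
  have := continuous_cubeVec (n := n)
  unfold cubeGauge
  fun_prop

theorem norm_cubeVec_le (s : Fin n → I) : ‖cubeVec s‖ ≤ 1 := by
  refine (pi_norm_le_iff_of_nonneg zero_le_one).mpr fun i => abs_le.mpr ?_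
  have := (s i).2
  constructor <;> simp only [cubeVec] <;> linarith [this.1, this.2]

theorem cubeGauge_pos (p : I × (Fin n → I)) : 0 < cubeGauge p :=
  lt_max_of_lt_left (by linarith [p.1.2.1])

theorem cubeGauge_le_one (p : I × (Fin n → I)) : cubeGauge p ≤ 1 :=
  max_le (by linarith [p.1.2.2]) (norm_cubeVec_le _)

theorem abs_cubeVec_div_le (p : I × (Fin n → I)) (i : Fin n) :
    |cubeVec p.2 i / cubeGauge p| ≤ 1 := by
  rw [abs_div, abs_of_pos (cubeGauge_pos p), div_le_one (cubeGauge_pos p)]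
  exact (norm_le_pi_norm (cubeVec p.2) i).trans (le_max_right _ _)

/-- The radial retraction of `I × Iⁿ` onto `{1} × Iⁿ ∪ I × ∂Iⁿ`. -/
noncomputable def cubeRetr (p : I × (Fin n → I)) : I × (Fin n → I) :=
  (⟨(1 + (p.1 : ℝ)) / cubeGauge p - 1, by
      have h : 1 ≤ (1 + (p.1 : ℝ)) / cubeGauge p := by
        rw [one_le_div (cubeGauge_pos p)]
        linarith [cubeGauge_le_one p, p.1.2.1]
      linarith, by
      have h : (1 + (p.1 : ℝ)) / cubeGauge p ≤ 2 := by
        rw [div_le_iff₀ (cubeGauge_pos p)]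
        have : (1 + (p.1 : ℝ)) / 2 ≤ cubeGauge p := le_max_left _ _
        linarith
      linarith⟩,
    fun i => ⟨(cubeVec p.2 i / cubeGauge p + 1) / 2, by
      have := abs_le.mp (abs_cubeVec_div_le p i)
      constructor <;> linarith [this.1, this.2]⟩)

theorem continuous_cubeRetr : Continuous (cubeRetr : I × (Fin n → I) → _) := by
  have h1 := continuous_cubeVec (n := n)
  have h2 := continuous_cubeGauge (n := n)
  have h3 : ∀ p : I × (Fin n → I), cubeGauge p ≠ 0 := fun p => (cubeGauge_pos p).ne'
  refine Continuous.prodMk ?_ (continuous_pi fun i => ?_)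
  · exact Continuous.subtype_mk (by fun_prop (disch := exact h3)) _
  · refine Continuous.subtype_mk ?_ _
    have h4 : Continuous fun p : I × (Fin n → I) => cubeVec p.2 i :=
      (continuous_apply i).comp (h1.comp continuous_snd)
    fun_prop (disch := exact h3)

theorem cubeRetr_of_gauge {p : I × (Fin n → I)} (h : cubeGauge p = 1) : cubeRetr p = p := by
  refine Prod.ext (Subtype.ext ?_) (funext fun i => Subtype.ext ?_)
  · simp [cubeRetr, h]
  · simp [cubeRetr, h, cubeVec]

theorem cubeRetr_one (s : Fin n → I) : cubeRetr (1, s) = (1, s) :=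
  cubeRetr_of_gauge <| le_antisymm (cubeGauge_le_one _) (le_max_of_le_left (by norm_num))

theorem cubeRetr_boundary (t : I) {s : Fin n → I} (hs : s ∈ Cube.boundary (Fin n)) :
    cubeRetr (t, s) = (t, s) := by
  obtain ⟨i, hi⟩ := hs
  refine cubeRetr_of_gauge <| le_antisymm (cubeGauge_le_one _) (le_max_of_le_right ?_)
  refine le_trans ?_ (norm_le_pi_norm (cubeVec s) i)
  rcases hi with hi | hi <;> norm_num [cubeVec, hi]

/-- The gauge is a maximum of two terms, and the term attaining it becomes extremal after division:
either the height reaches `1`, or some coordinate reaches an end of its interval. -/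
theorem cubeRetr_mem (p : I × (Fin n → I)) :
    (cubeRetr p).1 = 1 ∨ (cubeRetr p).2 ∈ Cube.boundary (Fin n) := by
  have hpos := cubeGauge_pos p
  rcases le_or_gt ‖cubeVec p.2‖ ((1 + (p.1 : ℝ)) / 2) with h | h
  · left
    have hg : cubeGauge p = (1 + (p.1 : ℝ)) / 2 := max_eq_left h
    refine Subtype.ext ?_
    have : (1 + (p.1 : ℝ)) = 2 * cubeGauge p := by rw [hg]; ring
    show (1 + (p.1 : ℝ)) / cubeGauge p - 1 = 1
    rw [this]
    field_simp
    norm_num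
  · right
    have hg : cubeGauge p = ‖cubeVec p.2‖ := max_eq_right h.le
    -- The sup norm is attained. Its positivity also rules out `n = 0`, where there is no
    -- coordinate.
    obtain ⟨i, hi⟩ : ∃ i, ‖cubeVec p.2‖ ≤ ‖cubeVec p.2 i‖ := by
      by_contra! hlt
      exact lt_irrefl _ ((pi_norm_lt_iff (hg ▸ hpos)).mpr hlt)
    refine ⟨i, ?_⟩
    rw [← hg, Real.norm_eq_abs] at hi
    have hi' : |cubeVec p.2 i| = cubeGauge p :=
      le_antisymm (hg ▸ norm_le_pi_norm (cubeVec p.2) i) hi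
    rcases abs_eq hpos.le |>.mp hi' with h' | h'
    · right
      refine Subtype.ext ?_
      show (cubeVec p.2 i / cubeGauge p + 1) / 2 = 1
      rw [h', div_self hpos.ne']
      norm_num
    · left
      refine Subtype.ext ?_
      show (cubeVec p.2 i / cubeGauge p + 1) / 2 = 0
      rw [h', neg_div, div_self hpos.ne']
      norm_num

end CubeRetraction

/-- An equivariant retraction of the cylinder `I × X` onto `{1} × X ∪ I × A`. -/
structure CylinderRetraction (X : GCW G) (A : Set X) where
  toFun : I × X → I × X
  continuous : Continuous toFun
  map_smul : ∀ (t : I) (g : G) (x : X), toFun (t, g • x) = ((toFun (t, x)).1, g • (toFun (t, x)).2)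
  map_one : ∀ x, toFun (1, x) = (1, x)
  map_mem : ∀ (t : I), ∀ x ∈ A, toFun (t, x) = (t, x)
  mem : ∀ p, (toFun p).1 = 1 ∨ (toFun p).2 ∈ A
  mem_of_isSubcomplex : ∀ (B : Set X), X.IsSubcomplex B → ∀ (t : I), ∀ x ∈ B, (toFun (t, x)).2 ∈ B

/-! ### Retraction of the cylinder over a complex, cell by cell. -/

namespace GCW

variable {X : GCW G}

/-- The cell whose open cell contains `x`, and the coordinates of `x`. -/
noncomputable def cellAt (x : X) : Σ e, (G ⧸ X.stab e) × (Fin (X.dim e) → I) :=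
  (X.char_bij x).choose

theorem cellAt_notMem (x : X) : (cellAt x).2.2 ∉ Cube.boundary (Fin (X.dim (cellAt x).1)) :=
  (X.char_bij x).choose_spec.1.1

theorem char_cellAt (x : X) : X.char (cellAt x).1 (cellAt x).2 = x :=
  (X.char_bij x).choose_spec.1.2

theorem cellAt_char {e : X.Cell} {a t} (h : t ∉ Cube.boundary (Fin (X.dim e))) :
    cellAt (X.char e (a, t)) = ⟨e, a, t⟩ :=
  cell_eq (cellAt_notMem _) h (char_cellAt _)

/-- This is what makes the recursion defining `cylinderRetr`, and the inductions that follow it,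
terminate. -/
theorem dim_cellAt_lt {e : X.Cell} (a) {t} (h : t ∈ Cube.boundary (Fin (X.dim e))) :
    X.dim (cellAt (X.char e (a, t))).1 < X.dim e := by
  obtain ⟨e', q, hd, hq⟩ := X.boundary e a t h
  exact (dim_le_of_char_eq (cellAt_notMem _) (hq.trans (char_cellAt _).symm)).trans_lt hd

open Classical in
/-- The retraction of `I × X` onto `{1} × X ∪ I × A` that is the radial retraction on each cell
outside `A`. -/
noncomputable def cylinderRetr (A : Set X) (t : I) (x : X) : I × X :=
  if x ∈ A then (t, x)
  -- At height `1` the target is reached. Otherwise the radial retraction has moved the point to the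
  -- boundary of its cell, hence into an open cell of smaller dimension, and the process is repeated
  -- there.
  else if _h : (cubeRetr (t, (cellAt x).2.2)).1 = 1 then
    (1, X.char (cellAt x).1 ((cellAt x).2.1, (cubeRetr (t, (cellAt x).2.2)).2))
  else
    cylinderRetr A (cubeRetr (t, (cellAt x).2.2)).1
      (X.char (cellAt x).1 ((cellAt x).2.1, (cubeRetr (t, (cellAt x).2.2)).2))
termination_by X.dim (cellAt x).1
decreasing_by exact dim_cellAt_lt _ ((cubeRetr_mem _).resolve_left _h)

theorem cylinderRetr_of_mem {A : Set X} (t : I) {x : X} (hx : x ∈ A) :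
    cylinderRetr A t x = (t, x) := by
  rw [cylinderRetr, if_pos hx]

theorem cylinderRetr_one (A : Set X) (x : X) : cylinderRetr A 1 x = (1, x) := by
  rw [cylinderRetr]
  split_ifs with h1 h2
  · rfl
  · rw [cubeRetr_one]
    exact Prod.ext rfl (char_cellAt x)
  · rw [cubeRetr_one] at h2
    exact (h2 rfl).elim

/-- Removes the choice of coordinates in `cellAt`: the recursion formula is valid on the whole
closed cell, because `cubeRetr` is the identity over the boundary. Continuity can then be tested on
one characteristic map at a time. -/
theorem cylinderRetr_char {A : Set X} {e : X.Cell}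
    (he : ∀ a t, t ∉ Cube.boundary (Fin (X.dim e)) → X.char e (a, t) ∉ A) (t : I) (a) (s) :
    cylinderRetr A t (X.char e (a, s)) =
      cylinderRetr A (cubeRetr (t, s)).1 (X.char e (a, (cubeRetr (t, s)).2)) := by
  by_cases hs : s ∈ Cube.boundary (Fin (X.dim e))
  · rw [cubeRetr_boundary t hs]
  · rw [cylinderRetr, if_neg (he a s hs), cellAt_char hs]
    split_ifs with h
    · rw [h, cylinderRetr_one]
    · rfl

theorem cylinderRetr_mem (A : Set X) (t : I) (x : X) :
    (cylinderRetr A t x).1 = 1 ∨ (cylinderRetr A t x).2 ∈ A := by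
  induction hn : X.dim (cellAt x).1 using Nat.strong_induction_on generalizing t x with
  | _ n ih =>
    rw [cylinderRetr]
    split_ifs with h1 h2
    · exact Or.inr h1
    · exact Or.inl rfl
    · exact ih _ (hn ▸ dim_cellAt_lt _ ((cubeRetr_mem _).resolve_left h2)) _ _ rfl

/-- Points only move within their closed cells. This lets a retraction for `(X, U)` be restricted to
one for `(V, U ∩ V)`. -/
theorem cylinderRetr_mem_of_isSubcomplex (A : Set X) {B : Set X} (hB : X.IsSubcomplex B) (t : I)
    {x : X} (hx : x ∈ B) : (cylinderRetr A t x).2 ∈ B := by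
  induction hn : X.dim (cellAt x).1 using Nat.strong_induction_on generalizing t x with
  | _ n ih =>
    have hcell : ∀ q, X.char (cellAt x).1 q ∈ B :=
      hB _ _ _ (cellAt_notMem x) ((char_cellAt x).symm ▸ hx)
    rw [cylinderRetr]
    split_ifs with h1 h2
    · exact hx
    · exact hcell _
    · exact ih _ (hn ▸ dim_cellAt_lt _ ((cubeRetr_mem _).resolve_left h2)) _ (hcell _) rfl

/-- The retraction changes only the cube coordinates, while `g` acts only on the coset coordinate.
-/
theorem cylinderRetr_smul {A : Set X} (hA : X.IsSubcomplex A) (t : I) (g : G) (x : X) :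
    cylinderRetr A t (g • x) = ((cylinderRetr A t x).1, g • (cylinderRetr A t x).2) := by
  induction hn : X.dim (cellAt x).1 using Nat.strong_induction_on generalizing t x with
  | _ n ih =>
    by_cases hx : x ∈ A
    · rw [cylinderRetr_of_mem t hx, cylinderRetr_of_mem t (hA.smul_mem g hx)]
    · obtain ⟨e, a, s, hs, rfl⟩ := mem_closedCell x
      have he : ∀ a t, t ∉ Cube.boundary (Fin (X.dim e)) → X.char e (a, t) ∉ A :=
        fun a' t' ht' h => hx (hA e a' t' ht' h _)
      rw [← X.char_smul, cylinderRetr_char he t (g • a) s, cylinderRetr_char he t a s, X.char_smul]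
      by_cases h : (cubeRetr (t, s)).1 = 1
      · rw [h, cylinderRetr_one, cylinderRetr_one]
      · refine ih _ ?_ _ _ rfl
        rw [← hn, cellAt_char hs]
        exact dim_cellAt_lt _ ((cubeRetr_mem _).resolve_left h)

/-- Continuity on skeleta, by induction. Over a cell outside `A`, the preimage of `C` is a union of
two closed sets: the points that the radial retraction `f` sends to height `1`, and those it sends
into the lower skeleton, where the induction hypothesis applies. -/
theorem isClosed_preimage_cylinderRetr {A : Set X} (hA : X.IsSubcomplex A) {C : Set (I × X)}
    (hC : IsClosed C) (n : ℕ) :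
    IsClosed {p : I × X | p.2 ∈ X.skel n ∧ cylinderRetr A p.1 p.2 ∈ C} := by
  induction n using Nat.strong_induction_on with
  | _ n ih =>
    refine isClosed_prod_of (fun p hp => hp.1) fun e he => ?_
    have he' : X.dim e < n := by exact_mod_cast he
    have hc := X.continuous_char e
    by_cases hA' : ∀ a t, t ∉ Cube.boundary (Fin (X.dim e)) → X.char e (a, t) ∉ A
    · let f : I × ((G ⧸ X.stab e) × (Fin (X.dim e) → I)) →
          I × ((G ⧸ X.stab e) × (Fin (X.dim e) → I)) :=
        fun p => ((cubeRetr (p.1, p.2.2)).1, p.2.1, (cubeRetr (p.1, p.2.2)).2)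
      have hf : Continuous f := by
        have h : Continuous fun p : I × ((G ⧸ X.stab e) × (Fin (X.dim e) → I)) =>
            cubeRetr (p.1, p.2.2) := continuous_cubeRetr.comp (by fun_prop)
        exact h.fst.prodMk ((by fun_prop : Continuous _).prodMk h.snd)
      have h1 : IsClosed ({p | (f p).1 = 1} ∩
          (fun p => (((1 : I), X.char e (f p).2) : I × X)) ⁻¹' C) :=
        (isClosed_singleton.preimage hf.fst).inter
          (hC.preimage (continuous_const.prodMk (hc.comp hf.snd)))
      have h2 := (ih _ he').preimage (f := fun p => ((f p).1, X.char e (f p).2))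
        (hf.fst.prodMk (hc.comp hf.snd))
      convert h1.union h2 using 1
      ext ⟨t, a, s⟩
      have hmem : X.char e (a, s) ∈ X.skel n := ⟨e, _, he, rfl⟩
      have hch := cylinderRetr_char hA' t a s
      simp only [Set.mem_preimage, Prod.map, id, Set.mem_ofPred_eq, Set.mem_union,
        Set.mem_inter_iff, hmem, true_and, hch]
      show cylinderRetr A (f (t, a, s)).1 (X.char e (f (t, a, s)).2) ∈ C ↔ _
      constructor
      · intro h
        by_cases ht : (f (t, a, s)).1 = 1
        · rw [ht, cylinderRetr_one] at h
          exact Or.inl ⟨ht, h⟩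
        · have hb := (cubeRetr_mem (t, s)).resolve_left ht
          obtain ⟨e'', q, hd, hq⟩ := X.boundary e a _ hb
          exact Or.inr ⟨⟨e'', q, by exact_mod_cast hd, hq⟩, h⟩
      · rintro (⟨ht, h⟩ | ⟨-, h⟩)
        · rw [ht, cylinderRetr_one]
          exact h
        · exact h
    · push Not at hA'
      obtain ⟨a, t, ht, hat⟩ := hA'
      have hall := hA e a t ht hat
      convert hC.preimage (f := Prod.map id (X.char e)) (by fun_prop) using 1
      ext ⟨t, q⟩
      have hmem : X.char e q ∈ X.skel n := ⟨e, _, he, rfl⟩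
      simp [cylinderRetr_of_mem t (hall q), hmem]

theorem continuous_cylinderRetr {A : Set X} (hA : X.IsSubcomplex A) :
    Continuous fun p : I × X => cylinderRetr A p.1 p.2 := by
  refine continuous_iff_isClosed.mpr fun C hC => isClosed_prod_of (n := ⊤) ?_ fun e _ => ?_
  · rintro ⟨t, x⟩ -
    obtain ⟨e, a, s, -, rfl⟩ := mem_closedCell x
    exact ⟨e, _, ENat.natCast_lt_top _, rfl⟩
  -- `skel n` contains the cells of dimension strictly below `n`, hence the `+ 1`.
  · convert (isClosed_preimage_cylinderRetr hA hC (X.dim e + 1)).preimage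
      (f := Prod.map id (X.char e)) (continuous_id.prodMap (X.continuous_char e)) using 1
    ext ⟨t, q⟩
    have hmem : X.char e q ∈ X.skel ((X.dim e + 1 : ℕ) : ℕ∞) :=
      ⟨e, _, by exact_mod_cast Nat.lt_succ_self _, rfl⟩
    simp only [Set.mem_preimage, Prod.map, id, Set.mem_ofPred_eq, hmem, true_and]

/-- The homotopy extension property of a pair of `G`-CW complexes. -/
theorem IsSubcomplex.nonempty_cylinderRetraction {A : Set X} (hA : X.IsSubcomplex A) :
    Nonempty (CylinderRetraction X A) :=
  ⟨{ toFun := fun p => cylinderRetr A p.1 p.2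
     continuous := continuous_cylinderRetr hA
     map_smul := fun t g x => cylinderRetr_smul hA t g x
     map_one := fun x => cylinderRetr_one A x
     map_mem := fun t _ hx => cylinderRetr_of_mem t hx
     mem := fun p => cylinderRetr_mem A p.1 p.2
     mem_of_isSubcomplex := fun _ hB t _ hx => cylinderRetr_mem_of_isSubcomplex A hB t hx }⟩

end GCW

/-! ### Constructions of maps and homotopies -/

theorem PtMap.ext {X Y : PtGCW G} {f g : PtMap X Y} (h : ∀ x, f.toFun x = g.toFun x) : f = g := by
  obtain ⟨⟨f, _, _⟩, _⟩ := f
  obtain ⟨⟨g, _, _⟩, _⟩ := g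
  obtain rfl : f = g := funext h
  rfl

/-- The constant map to the base point. -/
def PtMap.const (X Y : PtGCW G) : PtMap X Y where
  toFun _ := Y.base
  continuous := continuous_const
  map_smul g _ := (Y.smul_base g).symm
  map_base := rfl

/-- The composite of `G`-maps. -/
def GMap.comp {X Y Z : GCW G} (g : GMap Y Z) (f : GMap X Y) : GMap X Z where
  toFun x := g.toFun (f.toFun x)
  continuous := g.continuous.comp f.continuous
  map_smul a x := by rw [f.map_smul, g.map_smul]

/-- As `I` is locally compact, its product with a quotient map is again a quotient map; so
homotopies descend to `X/A`. -/
theorem Collapse.continuous_prod_lift {X : Type u} [TopologicalSpace X] {A : Set X} {Y : Type*}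
    [TopologicalSpace Y] (h : I × X → Y) (b : Y) (hb : ∀ t, ∀ x ∈ A, h (t, x) = b)
    (hh : Continuous h) :
    Continuous fun p : I × Collapse A => Collapse.lift (fun x => h (p.1, x)) b (hb p.1) p.2 := by
  have hq : IsQuotientMap (Quotient.mk (collapseSetoid A)) := isQuotientMap_quotient_mk'
  refine hq.continuous_lift_prod_right ?_
  refine (Homeomorph.prodSumDistrib (X := I) (Y := X) (Z := Unit)).symm.isQuotientMap.continuous_iff.mpr
    ?_
  refine continuous_sum_dom.mpr ⟨?_, ?_⟩
  · exact hh
  · exact continuous_const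

namespace GCW

variable {X : GCW G} {A : Set X}

/-- The quotient map `X → X/A`. -/
def quotMk (X : GCW G) (A : Set X) (hA : X.IsSubcomplex A) : GMap X (X.quot A hA).toGCW where
  toFun := Collapse.mk A
  continuous := Collapse.continuous_mk
  map_smul _ _ := rfl

/-- The pointed map on `X/A` that is induced by a map on `X` sending `A` to the base point. -/
def quotDesc (hA : X.IsSubcomplex A) {Y : PtGCW G} (f : GMap X Y.toGCW)
    (h : ∀ x ∈ A, f.toFun x = Y.base) : PtMap (X.quot A hA) Y where
  toFun := Collapse.lift f.toFun Y.base h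
  continuous := Collapse.continuous_lift _ _ f.continuous
  map_smul g p := by
    rcases Collapse.cases p with rfl | ⟨x, -, rfl⟩
    · exact (Y.smul_base g).symm
    · exact f.map_smul g x
  map_base := rfl

theorem quot_ext {hA : X.IsSubcomplex A} {Y : PtGCW G} {f g : PtMap (X.quot A hA) Y}
    (h : ∀ x : X, f.toFun (Collapse.mk A x) = g.toFun (Collapse.mk A x)) : f = g := by
  refine PtMap.ext fun p => ?_
  rcases Collapse.cases p with rfl | ⟨x, -, rfl⟩
  · exact f.map_base.trans g.map_base.symm
  · exact h x

theorem quot_homotopic {hA : X.IsSubcomplex A} {Y : PtGCW G} {f₀ f₁ : PtMap (X.quot A hA) Y}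
    (h : I × X → Y.carrier) (hc : Continuous h)
    (hs : ∀ (t : I) (g : G) (x : X), h (t, g • x) = g • h (t, x))
    (hb : ∀ t, ∀ x ∈ A, h (t, x) = Y.base)
    (h₀ : ∀ x, h (0, x) = f₀.toFun (Collapse.mk A x))
    (h₁ : ∀ x, h (1, x) = f₁.toFun (Collapse.mk A x)) : f₀.Homotopic f₁ := by
  refine ⟨fun p : I × Collapse A => Collapse.lift (fun x => h (p.1, x)) Y.base (hb p.1) p.2,
    Collapse.continuous_prod_lift h _ hb hc, fun t g p => ?_, fun t => rfl, fun p => ?_, fun p => ?_⟩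
  · rcases Collapse.cases p with rfl | ⟨x, -, rfl⟩
    · exact (Y.smul_base g).symm
    · exact hs t g x
  · rcases Collapse.cases p with rfl | ⟨x, -, rfl⟩
    · exact f₀.map_base.symm
    · exact h₀ x
  · rcases Collapse.cases p with rfl | ⟨x, -, rfl⟩
    · exact f₁.map_base.symm
    · exact h₁ x

section Extend

variable {V U : Set X} {Y : PtGCW G}

open Classical in
/-- The extension of a map on `V` by the base point. -/
noncomputable def extendFun (hV : X.IsSubcomplex V) (f : GMap (X.sub V hV) Y.toGCW) (x : X) :
    Y.carrier :=
  if h : x ∈ V then f.toFun (⟨x, h⟩ : V) else Y.base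

theorem extendFun_of_mem {hV : X.IsSubcomplex V} (f : GMap (X.sub V hV) Y.toGCW) {x : X}
    (h : x ∈ V) : extendFun hV f x = f.toFun (⟨x, h⟩ : V) := dif_pos h

theorem extendFun_of_notMem {hV : X.IsSubcomplex V} (f : GMap (X.sub V hV) Y.toGCW) {x : X}
    (h : x ∉ V) : extendFun hV f x = Y.base := dif_neg h

theorem extendFun_eq_base {hV : X.IsSubcomplex V} {f : GMap (X.sub V hV) Y.toGCW} {x : X}
    (h : ∀ h : x ∈ V, f.toFun (⟨x, h⟩ : V) = Y.base) : extendFun hV f x = Y.base := by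
  by_cases hx : x ∈ V
  · exact (extendFun_of_mem f hx).trans (h hx)
  · exact extendFun_of_notMem f hx

/-- The pointed map `X/A → Y`, for `X = U ∪ V` and `A ⊆ U`, that extends a map on `V` sending
`U ∩ V` to the base point. -/
noncomputable def extend (hU : X.IsSubcomplex U) (hV : X.IsSubcomplex V)
    (hUV : ∀ x, x ∈ U ∨ x ∈ V) (hA : X.IsSubcomplex A) (hAU : A ⊆ U)
    (f : GMap (X.sub V hV) Y.toGCW)
    (hf : ∀ (x : X) (h : x ∈ V), x ∈ U → f.toFun (⟨x, h⟩ : V) = Y.base) : PtMap (X.quot A hA) Y :=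
  quotDesc hA
    { toFun := extendFun hV f
      continuous := by
        rw [← continuousOn_univ, ← Set.eq_univ_of_forall hUV]
        -- On `U` the extension is constant and on `V` it is `f`; both pieces are closed and cover
        -- `X`.
        refine ContinuousOn.union_of_isClosed ?_ ?_ hU.isClosed hV.isClosed
        · exact continuousOn_const.congr fun x hx => extendFun_eq_base fun h => hf x h hx
        · rw [continuousOn_iff_continuous_domRestrict]
          have : Set.domRestrict V (extendFun hV f) = f.toFun :=
            funext fun p => extendFun_of_mem f p.2
          rw [this]
          exact f.continuous
      map_smul := by
        intro g x
        by_cases h : x ∈ V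
        · exact (extendFun_of_mem f (hV.smul_mem g h)).trans ((f.map_smul g (⟨x, h⟩ : V)).trans
            (congrArg (g • ·) (extendFun_of_mem f h).symm))
        · refine (extendFun_of_notMem f fun h' => h ((hV.smul_mem_iff g).mp h')).trans ?_
          exact (Y.smul_base g).symm.trans (congrArg (g • ·) (extendFun_of_notMem f h).symm) }
    (fun x hx => extendFun_eq_base fun h => hf x h (hAU hx))

end Extend

end GCW

/-! ### Consequences of the axioms -/

namespace MulCohTheory

variable (E : MulCohTheory.{u, v} G)

/-- The constant map factors through `Y → Y → Y/Y`, and exactness for the subcomplex `Y` of `Y`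
makes that composite zero in cohomology. -/
theorem map_const {X Y : PtGCW G} (y : E.obj Y) : E.map (PtMap.const X Y) y = 0 := by
  let Q := Y.toGCW.quot Set.univ GCW.isSubcomplex_univ
  let S := Y.sub Set.univ GCW.isSubcomplex_univ trivial
  have h : PtMap.const X Y = (PtMap.const Q Y).comp
      (((Y.collapse Set.univ GCW.isSubcomplex_univ trivial).comp
        (Y.incl Set.univ GCW.isSubcomplex_univ trivial)).comp (PtMap.const X S)) := rfl
  rw [h, E.map_comp, E.map_comp, E.map_comp,
    (E.exact Y Set.univ GCW.isSubcomplex_univ trivial).apply_apply_eq_zero, map_zero]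

theorem map_eq_zero_of_forall {X Y : PtGCW G} {f : PtMap X Y} (h : ∀ x, f.toFun x = Y.base)
    (y : E.obj Y) : E.map f y = 0 := by
  rw [show f = PtMap.const X Y from PtMap.ext h, E.map_const]

theorem map_map_of_comp_eq {X Y Z W : PtGCW G} {g : PtMap Y Z} {f : PtMap X Y} {g' : PtMap W Z}
    {f' : PtMap X W} (h : g.comp f = g'.comp f') (z : E.obj Z) :
    E.map f (E.map g z) = E.map f' (E.map g' z) := by
  rw [← E.map_comp, ← E.map_comp, h]

theorem map_map_of_comp_eq_id {X Y : PtGCW G} {g : PtMap X Y} {f : PtMap Y X}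
    (h : f.comp g = PtMap.id X) (x : E.obj X) : E.map g (E.map f x) = x := by
  rw [← E.map_comp, h, E.map_id]

theorem map_map_of_homotopic_id {X Y : PtGCW G} {g : PtMap X Y} {f : PtMap Y X}
    (h : (f.comp g).Homotopic (PtMap.id X)) (x : E.obj X) : E.map g (E.map f x) = x := by
  rw [← E.map_comp, E.homotopy _ _ h, E.map_id]

variable {X : GCW G} {A P : Set X}

/-- Exactness of `Ẽ(X/(A ∪ P)) → Ẽ(X/A) → Ẽ(P/(A ∩ P))`. -/
theorem exists_map_eq_of_map_eq_zero (hA : X.IsSubcomplex A) (hP : X.IsSubcomplex P)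
    (y : E.obj (X.quot A hA))
    (hy : E.map (GCW.quotMap (hP.preimage_sub hA) hA (X.incl P hP) fun _ h => h) y = 0) :
    ∃ z, E.map (GCW.quotMap hA (hA.union hP) (GMap.id X) fun _ h => Or.inl h) z = y := by
  let Q := X.quot A hA
  -- `S` is the image of `P` in `X/A`, with the base point. The exactness axiom applies to `S ⊆
  -- X/A`, and the work lies in identifying `S` with `P/(A ∩ P)`.
  let S : Set (Collapse A) := {p | p = Collapse.pt A ∨ ∃ x ∈ P, p = Collapse.mk A x}
  have hS : Q.IsSubcomplex S := by
    rintro (e | e) a t ht hp q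
    · refine Or.inr ⟨X.char e.1 q, ?_, rfl⟩
      rcases hp with hp | ⟨x, hx, hp⟩
      · exact (e.2 a t ht (Collapse.mk_eq_pt.mp hp)).elim
      · rcases Collapse.mk_eq_mk.mp hp with h | h
        · exact hP e.1 a t ht (h ▸ hx) q
        · exact (e.2 a t ht h.1).elim
    · exact Or.inl rfl
  have hb : Q.base ∈ S := Or.inl rfl
  let A' : Set P := Subtype.val ⁻¹' A
  let i : Collapse A' → S := fun p => ⟨Collapse.lift (fun x : P => Collapse.mk A x.1) (Collapse.pt A)
    (fun x hx => Collapse.mk_eq_pt.mpr hx) p, by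
      rcases Collapse.cases p with rfl | ⟨x, -, rfl⟩
      · exact Or.inl rfl
      · exact Or.inr ⟨x.1, x.2, rfl⟩⟩
  have hi_inj : Function.Injective i := by
    intro p p' h
    have h := congrArg Subtype.val h
    rcases Collapse.cases p with rfl | ⟨x, hx, rfl⟩ <;>
      rcases Collapse.cases p' with rfl | ⟨x', hx', rfl⟩
    · rfl
    · exact (hx' (Collapse.mk_eq_pt (A := A).mp h.symm)).elim
    · exact (hx (Collapse.mk_eq_pt (A := A).mp h)).elim
    · rcases Collapse.mk_eq_mk.mp h with h | h
      · rw [Subtype.ext h]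
      · exact (hx h.1).elim
  have hi_surj : Function.Surjective i := by
    rintro ⟨p, rfl | ⟨x, hx, rfl⟩⟩
    · exact ⟨Collapse.pt A', rfl⟩
    · exact ⟨Collapse.mk A' ⟨x, hx⟩, rfl⟩
  let k := Equiv.ofBijective i ⟨hi_inj, hi_surj⟩
  have hk : Continuous k.symm := by
    refine continuous_iff_isClosed.mpr fun C hC => ?_
    have h1 : IsClosed (Subtype.val '' (Collapse.mk A' ⁻¹' C) : Set X) :=
      hP.isClosed.isClosedEmbedding_subtypeVal.isClosedMap _ (Collapse.isClosed_iff.mp hC)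
    have h2 : IsClosed (Subtype.val '' (i '' C) : Set (Collapse A)) := by
      rw [Collapse.isClosed_iff]
      -- The preimage in `X` of the image of `C` is the part of `P` lying over `C`, together with
      -- all of `A` when `C` contains the base point.
      by_cases hpt : Collapse.pt A' ∈ C
      · convert h1.union hA.isClosed using 1
        ext x
        constructor
        · rintro ⟨_, ⟨p, hp, rfl⟩, hx⟩
          rcases Collapse.cases p with rfl | ⟨x', -, rfl⟩
          · exact Or.inr (Collapse.mk_eq_pt.mp hx.symm)
          · rcases Collapse.mk_eq_mk.mp hx with h | h
            · exact Or.inl ⟨x', hp, h⟩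
            · exact Or.inr h.2
        · rintro (⟨x', hx', rfl⟩ | hx)
          · exact ⟨_, ⟨_, hx', rfl⟩, rfl⟩
          · exact ⟨_, ⟨_, hpt, rfl⟩, (Collapse.mk_eq_pt.mpr hx).symm⟩
      · convert h1 using 1
        ext x
        constructor
        · rintro ⟨_, ⟨p, hp, rfl⟩, hx⟩
          rcases Collapse.cases p with rfl | ⟨x', hx', rfl⟩
          · exact (hpt hp).elim
          · rcases Collapse.mk_eq_mk.mp hx with h | h
            · exact ⟨x', hp, h⟩
            · exact (hx' h.1).elim
        · rintro ⟨x', hx', rfl⟩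
          exact ⟨_, ⟨_, hx', rfl⟩, rfl⟩
    have h3 := h2.preimage (continuous_subtype_val (p := (· ∈ S)))
    rw [Set.preimage_image_eq _ Subtype.val_injective] at h3
    have h4 : k.symm ⁻¹' C = i '' C := (k.image_eq_preimage_symm C).symm
    rw [h4]
    exact h3
  let T := (X.sub P hP).quot A' (hP.preimage_sub hA)
  let j : (Q.sub S hS hb).carrier → T.carrier := k.symm
  have hj : ∀ (g : G) (p : (Q.sub S hS hb).carrier), j (g • p) = g • j p := by
    intro g p
    obtain ⟨p, rfl⟩ : ∃ p' : T.carrier, k p' = p := k.surjective p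
    have hjp : j (k p) = p := k.symm_apply_apply p
    rw [hjp]
    refine k.symm_apply_eq.mpr (Subtype.ext ?_)
    rcases Collapse.cases p with rfl | ⟨x, -, rfl⟩
    · rfl
    · rfl
  let κ : PtMap (Q.sub S hS hb) T :=
    { toFun := j
      continuous := hk
      map_smul := hj
      map_base := k.symm_apply_eq.mpr rfl }
  have hκ : (GCW.quotMap (hP.preimage_sub hA) hA (X.incl P hP) fun _ h => h).comp κ =
      Q.incl S hS hb := by
    refine PtMap.ext fun p => ?_
    obtain ⟨p, rfl⟩ : ∃ p' : Collapse A', k p' = p := k.surjective p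
    show (i (k.symm (k p))).1 = (k p).1
    rw [k.symm_apply_apply]
    rfl
  have h0 : E.map (Q.incl S hS hb) y = 0 := by
    rw [← hκ, E.map_comp, hy, map_zero]
  obtain ⟨z, rfl⟩ := (E.exact Q S hS hb y).mp h0
  -- Only this direction of the identification of `X/(A ∪ P)` with `(X/A)/S` is needed, to transport
  -- the class `z`.
  let ρ : PtMap (X.quot (A ∪ P) (hA.union hP)) (Q.toGCW.quot S hS) :=
    GCW.quotDesc _ ((Q.toGCW.quotMk S hS).comp (X.quotMk A hA)) <| by
      rintro x (hx | hx)
      · exact Collapse.mk_eq_pt.mpr (Or.inl (Collapse.mk_eq_pt.mpr hx))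
      · exact Collapse.mk_eq_pt.mpr (Or.inr ⟨x, hx, rfl⟩)
  refine ⟨E.map ρ z, ?_⟩
  rw [← E.map_comp]
  exact congrArg (fun f => E.map f z) (GCW.quot_ext fun x => rfl)

end MulCohTheory

namespace GCW

variable {X : GCW G} {A B : Set X}

/-! ### The equivalence of the mapping cone with the quotient -/

section Cone

variable (hA : X.IsSubcomplex A) (hB : X.IsSubcomplex B)
  (R : CylinderRetraction (X.sub A hA) (Subtype.val ⁻¹' B : Set A))

/-- The complex `{1} × A ∪ I × B`. -/
abbrev coneComplex : GCW G := (X.prod cwI).sub (coneSet A B) (coneSet_sub hA hB)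

/-- The quotient map `{1} × A ∪ I × B → A ∪ CB`. -/
def coneMk : GMap (coneComplex hA hB) (cone hA hB).toGCW := quotMk _ _ _

theorem coneMk_eq_base {p : coneSet A B} (h : p.1.1 = 0) :
    (coneMk hA hB).toFun p = (cone hA hB).base := Collapse.mk_eq_pt.mpr ⟨h, trivial⟩

/-- A cylinder retraction, as a map into `{1} × A ∪ I × B`. -/
def cylToConeSet (p : I × X.sub A hA) : coneSet A B :=
  ⟨((R.toFun p).1, (X.incl A hA).toFun (R.toFun p).2),
    (R.mem p).imp (fun h => ⟨h, ((R.toFun p).2 : A).2⟩) (fun h => ⟨trivial, h⟩)⟩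

theorem continuous_cylToConeSet : Continuous (cylToConeSet hA R) :=
  (R.continuous.fst.prodMk ((X.incl A hA).continuous.comp R.continuous.snd)).subtype_mk _

theorem cylToConeSet_smul (t : I) (g : G) (x : X.sub A hA) :
    (cylToConeSet hA R (t, g • x) : (coneComplex hA hB).carrier) =
      g • (show (coneComplex hA hB).carrier from cylToConeSet hA R (t, x)) := by
  refine Subtype.ext ?_
  show ((R.toFun (t, g • x)).1, (X.incl A hA).toFun (R.toFun (t, g • x)).2) =
    ((R.toFun (t, x)).1, g • (X.incl A hA).toFun (R.toFun (t, x)).2)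
  rw [R.map_smul]
  exact Prod.ext rfl ((X.incl A hA).map_smul _ _)

/-- The map into `{1} × A ∪ I × B` given by a cylinder retraction at the bottom of the cylinder. -/
def bottomToCone : GMap (X.sub A hA) (coneComplex hA hB) where
  toFun x := cylToConeSet hA R (0, x)
  continuous := (continuous_cylToConeSet hA R).comp (by fun_prop)
  map_smul g x := cylToConeSet_smul hA hB R 0 g x

theorem cylToConeSet_coneSet (p : coneSet A B) (hp : p.1.2 ∈ A) :
    cylToConeSet hA R (p.1.1, (⟨p.1.2, hp⟩ : A)) = p := by
  have h : R.toFun (p.1.1, (⟨p.1.2, hp⟩ : A)) = (p.1.1, (⟨p.1.2, hp⟩ : A)) := by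
    obtain ⟨⟨t, x⟩, ⟨h, -⟩ | ⟨-, h⟩⟩ := p
    · obtain rfl : t = 1 := h
      exact R.map_one _
    · exact R.map_mem t _ h
  refine Subtype.ext ?_
  show ((R.toFun (p.1.1, (⟨p.1.2, hp⟩ : A))).1, (X.incl A hA).toFun
    (R.toFun (p.1.1, (⟨p.1.2, hp⟩ : A))).2) = p.1
  rw [h]
  rfl

theorem cylToConeSet_of_mem (t : I) (x : A) (hx : x.1 ∈ B) :
    (cylToConeSet hA R (t, x)).1 = (t, x.1) := by
  show ((R.toFun (t, x)).1, (X.incl A hA).toFun (R.toFun (t, x)).2) = _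
  rw [R.map_mem t x hx]
  rfl

/-- The homotopy inverse `A/B → A ∪ CB` of the map that collapses the cone. -/
def quotToCone : PtMap (subquot hA hB) (cone hA hB) :=
  quotDesc (hA.preimage_sub hB) ((coneMk hA hB).comp (bottomToCone hA hB R))
    (fun x hx => coneMk_eq_base hA hB (congrArg Prod.fst (cylToConeSet_of_mem hA R 0 x hx)))

theorem mem_of_coneSet (hBA : B ⊆ A) (p : coneSet A B) : p.1.2 ∈ A :=
  p.2.elim (fun h => h.2) fun h => hBA h.2

/-- The homotopy at time `s` sends `(t, x)` to `R(s t, x)`. It starts at the bottom of the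
retraction and ends at the identity, as `R` fixes `{1} × A ∪ I × B`. -/
theorem quotToCone_comp_homotopic (hBA : B ⊆ A) :
    ((quotToCone hA hB R).comp (coneToQuot hA hB hBA)).Homotopic (PtMap.id _) := by
  let f : I × coneSet A B → I × X.sub A hA :=
    fun p => (p.1 * p.2.1.1, (⟨p.2.1.2, mem_of_coneSet hBA p.2⟩ : A))
  have hf : Continuous f := by
    refine Continuous.prodMk (by fun_prop) ?_
    exact Continuous.subtype_mk (by fun_prop) _
  refine quot_homotopic (fun p => (coneMk hA hB).toFun (cylToConeSet hA R (f p)))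
    ((coneMk hA hB).continuous.comp ((continuous_cylToConeSet hA R).comp hf)) (fun t g x => ?_)
    (fun t x hx => ?_) (fun x => ?_) (fun x => ?_)
  · exact (congrArg (coneMk hA hB).toFun (cylToConeSet_smul hA hB R (f (t, x)).1 g
      (f (t, x)).2)).trans ((coneMk hA hB).map_smul g _)
  · have h0 : x.1.1 = 0 := hx.1
    have hxB : x.1.2 ∈ B := x.2.elim (fun h => (zero_ne_one (h0.symm.trans h.1)).elim) fun h => h.2
    refine coneMk_eq_base hA hB ?_
    refine (congrArg Prod.fst (cylToConeSet_of_mem hA R _ _ hxB)).trans ?_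
    show t * x.1.1 = 0
    rw [h0, mul_zero]
  · refine congrArg (fun s => (coneMk hA hB).toFun (cylToConeSet hA R (s, _))) ?_
    exact zero_mul _
  · refine congrArg (coneMk hA hB).toFun (Eq.trans ?_ (cylToConeSet_coneSet hA R x
      (mem_of_coneSet hBA x)))
    refine congrArg (fun s => cylToConeSet hA R (s, _)) ?_
    exact one_mul _

/-- After the cone is collapsed, only the second coordinate of `R(t, x)` remains; letting `t` run to
`1` deforms it to `x`, while `B` stays in `B`. -/
theorem coneToQuot_comp_homotopic (hBA : B ⊆ A) :
    ((coneToQuot hA hB hBA).comp (quotToCone hA hB R)).Homotopic (PtMap.id _) := by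
  let q := (X.sub A hA).quotMk _ (hA.preimage_sub hB)
  refine quot_homotopic (fun p => q.toFun (R.toFun p).2)
    (q.continuous.comp R.continuous.snd) (fun t g x => ?_)
    (fun t x hx => ?_) (fun x => rfl) (fun x => ?_)
  · exact (congrArg q.toFun (congrArg Prod.snd (R.map_smul t g x))).trans (q.map_smul g _)
  · refine Collapse.mk_eq_pt.mpr ?_
    rw [R.map_mem t x hx]
    exact hx
  · rw [R.map_one]
    rfl

end Cone

/-! ### Excision -/

section Excision

variable {U V : Set X} (hU : X.IsSubcomplex U) (hV : X.IsSubcomplex V)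

/-- The excision map `V/(U ∩ V) → X/U`. -/
def excision : PtMap (subquot hV (hU.inter hV)) (X.quot U hU) :=
  quotMap (hV.preimage_sub (hU.inter hV)) hU (X.incl V hV) fun _ h => h.1

variable (hUV : ∀ x, x ∈ U ∨ x ∈ V)

/-- The inverse `X/U → V/(U ∩ V)` of the excision map, for `X = U ∪ V`. -/
noncomputable def excisionInv : PtMap (X.quot U hU) (subquot hV (hU.inter hV)) :=
  extend hU hV hUV hU subset_rfl ((X.sub V hV).quotMk _ (hV.preimage_sub (hU.inter hV)))
    (fun _ h hx => Collapse.mk_eq_pt.mpr ⟨hx, h⟩)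

theorem excisionInv_comp : (excisionInv hU hV hUV).comp (excision hU hV) = PtMap.id _ :=
  quot_ext fun x => extendFun_of_mem _ (x : V).2

theorem excision_comp : (excision hU hV).comp (excisionInv hU hV hUV) = PtMap.id _ := by
  refine quot_ext fun x => ?_
  by_cases h : x ∈ V
  · exact congrArg (excision hU hV).toFun (extendFun_of_mem (hV := hV)
      ((X.sub V hV).quotMk _ (hV.preimage_sub (hU.inter hV))) h)
  · refine (congrArg (excision hU hV).toFun (extendFun_of_notMem (hV := hV)
      ((X.sub V hV).quotMk _ (hV.preimage_sub (hU.inter hV))) h)).trans ?_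
    exact (Collapse.mk_eq_pt.mpr ((hUV x).resolve_right h)).symm

end Excision

end GCW

/-! ### Cohomology of mapping cones, and classes that vanish on two pieces. -/

namespace MulCohTheory

variable (E : MulCohTheory.{u, v} G) {X : GCW G}

section

variable {A B : Set X} (hA : X.IsSubcomplex A) (hB : X.IsSubcomplex B) (hBA : B ⊆ A)
  (R : CylinderRetraction (X.sub A hA) (Subtype.val ⁻¹' B : Set A))

theorem map_quotToCone_coneToQuot (y : E.obj (GCW.subquot hA hB)) :
    E.map (GCW.quotToCone hA hB R) (E.map (GCW.coneToQuot hA hB hBA) y) = y :=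
  E.map_map_of_homotopic_id (GCW.coneToQuot_comp_homotopic hA hB R hBA) y

theorem map_coneToQuot_quotToCone (y : E.obj (GCW.cone hA hB)) :
    E.map (GCW.coneToQuot hA hB hBA) (E.map (GCW.quotToCone hA hB R) y) = y :=
  E.map_map_of_homotopic_id (GCW.quotToCone_comp_homotopic hA hB R hBA) y

end

/-- If `X` retracts onto `A`, then `Ẽ(X/A) → E(X)` is injective. -/
theorem map_quot_eq_zero {A : Set X} (hA : X.IsSubcomplex A) (r : GMap X X)
    (hr : ∀ x, r.toFun x ∈ A) (hrA : ∀ x ∈ A, r.toFun x = x) (u : E.obj (X.quot A hA))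
    (hu : E.map (GCW.quotMap GCW.isSubcomplex_empty hA (GMap.id X) fun _ h => h.elim) u = 0) :
    u = 0 := by
  have hX : X.IsSubcomplex Set.univ := GCW.isSubcomplex_univ
  obtain ⟨R⟩ := (hX.preimage_sub hA).nonempty_cylinderRetraction
  let T := (X.prod cwI).sub (GCW.coneSet Set.univ A) (GCW.coneSet_sub hX hA)
  let T₀ : Set (GCW.coneSet (Set.univ : Set X) A) :=
    Subtype.val ⁻¹' ({0} ×ˢ Set.univ : Set (I × X))
  let T₁ : Set (GCW.coneSet (Set.univ : Set X) A) :=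
    Subtype.val ⁻¹' ({1} ×ˢ Set.univ : Set (I × X))
  have h₀ : T.IsSubcomplex T₀ :=
    (GCW.coneSet_sub hX hA).preimage_sub (GCW.isSubcomplex_prod cwI_zero hX)
  have h₁ : T.IsSubcomplex T₁ :=
    (GCW.coneSet_sub hX hA).preimage_sub (GCW.isSubcomplex_prod cwI_one hX)
  -- the quotient map `C → X/A` and its homotopy inverse
  let f : PtMap (GCW.subquot hX hA) (X.quot A hA) :=
    GCW.quotMap (hX.preimage_sub hA) hA (X.incl _ hX) fun _ h => h
  let f' : PtMap (X.quot A hA) (GCW.subquot hX hA) :=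
    GCW.quotMap hA (hX.preimage_sub hA)
      { toFun := fun x => (⟨x, trivial⟩ : (Set.univ : Set X))
        continuous := continuous_id.subtype_mk _
        map_smul := fun _ _ => rfl } fun _ h => h
  have hf : f.comp f' = PtMap.id _ := GCW.quot_ext fun _ => rfl
  -- The class `u` seen on the mapping cone `X ∪ CA`, which is equivalent to `X/A`.
  let y := E.map (GCW.coneToQuot hX hA (Set.subset_univ A)) (E.map f u)
  suffices hy : y = 0 by
    have h1 : E.map f u = 0 := by
      rw [← E.map_quotToCone_coneToQuot hX hA (Set.subset_univ A) R (E.map f u)]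
      exact (congrArg _ hy).trans (map_zero _)
    rw [← E.map_map_of_comp_eq_id hf u, h1, map_zero]
  -- the restriction to the base of the cone
  have hy : E.map (GCW.quotMap (h₁.preimage_sub h₀) h₀ (T.incl T₁ h₁) fun _ h => h) y = 0 := by
    -- The base `T₁ = {1} × X` of the cone is a copy of `X` disjoint from `T₀`, so restricting `y`
    -- to it amounts to pulling `u` back to `E(X)`.
    let k : PtMap ((T.sub T₁ h₁).quot (Subtype.val ⁻¹' T₀ : Set T₁) (h₁.preimage_sub h₀)) X.plus :=
      GCW.quotDesc _
        { toFun := (fun p => Collapse.mk ∅ p.1.1.2 : T₁ → Collapse (∅ : Set X))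
          continuous := Collapse.continuous_mk.comp
            (continuous_snd.comp (continuous_subtype_val.comp continuous_subtype_val))
          map_smul := fun _ _ => rfl }
        (fun (p : T₁) hp => (zero_ne_one (hp.1.symm.trans p.2.1)).elim)
    refine (E.map_map_of_comp_eq (g := f.comp (GCW.coneToQuot hX hA (Set.subset_univ A)))
      (g' := GCW.quotMap GCW.isSubcomplex_empty hA (GMap.id X) fun _ h => h.elim)
      (f' := k) (GCW.quot_ext fun _ => rfl) u |> (congrArg _ (E.map_comp _ _ u).symm).trans).trans ?_
    exact (congrArg (E.map k) hu).trans (map_zero _)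
  obtain ⟨z, hz⟩ := E.exists_map_eq_of_map_eq_zero h₀ h₁ y hy
  -- By exactness `y` comes from the cone with its base collapsed. The collapse is null-homotopic:
  -- once the base is a point, `r` can be applied to `x`, which places everything in `I × A`, where
  -- the height can be contracted to `0`.
  suffices hn : (GCW.quotMap h₀ (h₀.union h₁) (GMap.id T) fun _ h => Or.inl h).Homotopic
      (PtMap.const _ _) by
    rw [← hz, E.homotopy _ _ hn]
    exact E.map_const z
  -- the null homotopy
  let h : I × GCW.coneSet (Set.univ : Set X) A → GCW.coneSet (Set.univ : Set X) A :=
    fun p => ⟨(σ p.1 * p.2.1.1, r.toFun p.2.1.2), Or.inr ⟨trivial, hr _⟩⟩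
  have hh : Continuous h := by
    have := r.continuous
    exact Continuous.subtype_mk (by fun_prop) _
  let q := T.quotMk (T₀ ∪ T₁) (h₀.union h₁)
  refine GCW.quot_homotopic (X := T) (hA := h₀) (fun p => q.toFun (h p)) (q.continuous.comp hh)
    (fun t g p => ?_) (fun t p hp => ?_) (fun p => ?_) (fun p => ?_)
  · exact congrArg q.toFun (Subtype.ext (Prod.ext rfl (r.map_smul g _)))
  · refine Collapse.mk_eq_pt.mpr (Or.inl ⟨?_, trivial⟩)
    have h0 : p.1.1 = 0 := hp.1
    show σ t * p.1.1 = 0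
    rw [h0, mul_zero]
  -- At time `0` the point `(s, x)` goes to `(s, r x)`. This is the same class: at height `1` both
  -- points are collapsed, and elsewhere `x ∈ A` is fixed by `r`.
  · have hσ : σ 0 * p.1.1 = p.1.1 := by rw [unitInterval.symm_zero, _root_.one_mul]
    refine Collapse.mk_eq_mk.mpr ?_
    rcases p.2 with hp | hp
    · exact Or.inr ⟨Or.inr ⟨hσ.trans hp.1, trivial⟩, Or.inr ⟨hp.1, trivial⟩⟩
    · exact Or.inl (Subtype.ext (Prod.ext hσ (hrA _ hp.2)))
  · refine Collapse.mk_eq_pt.mpr (Or.inl ⟨?_, trivial⟩)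
    show σ 1 * p.1.1 = 0
    rw [unitInterval.symm_one, zero_mul]

/-- For `X = P ∪ Q`, where `Q` retracts onto `P ∩ Q`, a class that restricts to zero on `P` and on
`Q` is zero. -/
theorem eq_zero_of_res_eq_zero {P Q : Set X} (hP : X.IsSubcomplex P) (hQ : X.IsSubcomplex Q)
    (hPQ : ∀ x, x ∈ P ∨ x ∈ Q) (r : GMap (X.sub Q hQ) (X.sub Q hQ))
    (hr : ∀ x, (X.incl Q hQ).toFun (r.toFun x) ∈ P)
    (hrP : ∀ x : Q, x.1 ∈ P → r.toFun x = x) (y : E.H X) (h₁ : E.res hP y = 0)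
    (h₂ : E.res hQ y = 0) : y = 0 := by
  obtain ⟨z, rfl⟩ : ∃ z, E.map (GCW.quotMap GCW.isSubcomplex_empty hP (GMap.id X)
      fun _ h => h.elim) z = y := by
    obtain ⟨z, hz⟩ := E.exists_map_eq_of_map_eq_zero GCW.isSubcomplex_empty hP y h₁
    have hE : ∅ ∪ P ⊆ P := Set.union_subset (Set.empty_subset _) subset_rfl
    refine ⟨E.map (GCW.quotMap hP (GCW.isSubcomplex_empty.union hP) (GMap.id X)
      fun _ h => Or.inr h) z, ?_⟩
    rw [← hz, ← E.map_comp]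
    exact congrArg (fun f => E.map f z) (GCW.quot_ext fun _ => rfl)
  -- By excision `z` may be viewed in `Ẽ(Q/(P ∩ Q))`, which injects into `E(Q)` because `Q` retracts
  -- onto `P ∩ Q`.
  suffices h : E.map (GCW.excision hP hQ) z = 0 by
    rw [← E.map_map_of_comp_eq_id (GCW.excision_comp hP hQ hPQ) z, h, map_zero]
    exact map_zero _
  refine E.map_quot_eq_zero (hQ.preimage_sub (hP.inter hQ)) r (fun x => ⟨hr x, (r.toFun x : Q).2⟩)
    (fun x hx => hrP x hx.1) _ ?_
  have h₂' : E.map (GCW.plusMap (X.incl Q hQ)) (E.map _ z) = 0 := h₂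
  refine Eq.trans ?_ h₂'
  refine E.map_map_of_comp_eq ?_ z
  exact GCW.quot_ext fun _ => rfl

end MulCohTheory

/-! ### The Mayer-Vietoris connecting map -/

/-- The restriction of a cylinder retraction to a subcomplex. -/
def CylinderRetraction.restrict {X : GCW G} {U V : Set X} (R : CylinderRetraction X U)
    (hV : X.IsSubcomplex V) : CylinderRetraction (X.sub V hV) (Subtype.val ⁻¹' (U ∩ V) : Set V) where
  toFun p := ((R.toFun (p.1, (X.incl V hV).toFun p.2)).1,
    (⟨(R.toFun (p.1, (X.incl V hV).toFun p.2)).2, R.mem_of_isSubcomplex V hV _ _ (p.2 : V).2⟩ : V))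
  continuous := by
    have h : Continuous fun p : I × X.sub V hV => R.toFun (p.1, (X.incl V hV).toFun p.2) :=
      R.continuous.comp (continuous_fst.prodMk ((X.incl V hV).continuous.comp continuous_snd))
    exact h.fst.prodMk (h.snd.subtype_mk _)
  map_smul t g x := by
    have h := R.map_smul t g ((X.incl V hV).toFun x)
    exact Prod.ext (congrArg Prod.fst h :) (Subtype.ext (congrArg Prod.snd h :))
  map_one x := by
    have h := R.map_one ((X.incl V hV).toFun x)
    exact Prod.ext (congrArg Prod.fst h :) (Subtype.ext (congrArg Prod.snd h :))
  map_mem t x hx := by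
    have h := R.map_mem t ((X.incl V hV).toFun x) hx.1
    exact Prod.ext (congrArg Prod.fst h :) (Subtype.ext (congrArg Prod.snd h :))
  mem p := (R.mem _).imp (fun h => h) fun h => ⟨h, R.mem_of_isSubcomplex V hV _ _ (p.2 : V).2⟩
  mem_of_isSubcomplex B hB t x hx := by
    -- A subcomplex of `V` is one of `X`: a cell whose open cell meets it is a cell of `V`.
    have hB' : X.IsSubcomplex (Subtype.val '' (B : Set V) : Set X) := by
      rintro e a s hs ⟨y, hy, hye⟩ q
      have he : ∀ q, X.char e q ∈ V := hV e a s hs (hye ▸ y.2)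
      have hy' : (⟨X.char e (a, s), he _⟩ : V) ∈ (B : Set V) := by
        rwa [show (⟨X.char e (a, s), he _⟩ : V) = y from Subtype.ext hye.symm]
      exact ⟨_, hB ⟨e, he⟩ a s hs hy' q, rfl⟩
    obtain ⟨y, hy, hye⟩ := R.mem_of_isSubcomplex _ hB' t x.1 ⟨x, hx, rfl⟩
    have hyx : y = (⟨(R.toFun (t, x.1)).2, R.mem_of_isSubcomplex V hV _ _ (x : V).2⟩ : V) :=
      Subtype.ext hye
    exact hyx ▸ hy

namespace GCW

variable {X : GCW G} {U V W : Set X}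

/-! ### The complex `X` with a circle attached at each point of `W`. -/

section Circles

/-- The subset `{0} × X ∪ S¹ × W` of `S¹ × X`. -/
def circleSet (W : Set X) : Set (S1 × X) := {0} ×ˢ Set.univ ∪ Set.univ ×ˢ W

theorem circleSet_sub (hW : X.IsSubcomplex W) : (X.prod cwS1).IsSubcomplex (circleSet W) :=
  (isSubcomplex_prod cwS1_zero isSubcomplex_univ).union
    (isSubcomplex_prod cwS1.isSubcomplex_univ hW)

variable (hW : X.IsSubcomplex W)

/-- The complex `{0} × X ∪ S¹ × W`, which is `X` with a circle attached at each point of `W`. -/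
def circles : GCW G := (X.prod cwS1).sub (circleSet W) (circleSet_sub hW)

/-- The subcomplex `{0} × X` of `{0} × X ∪ S¹ × W`. -/
def circlesBase (W : Set X) : Set (circleSet W) := Subtype.val ⁻¹' ({0} ×ˢ Set.univ : Set (S1 × X))

/-- The subcomplex `S¹ × W` of `{0} × X ∪ S¹ × W`. -/
def circlesTop (W : Set X) : Set (circleSet W) := Subtype.val ⁻¹' (Set.univ ×ˢ W : Set (S1 × X))

theorem circlesBase_sub : (circles hW).IsSubcomplex (circlesBase W) :=
  (circleSet_sub hW).preimage_sub (isSubcomplex_prod cwS1_zero isSubcomplex_univ)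

theorem circlesTop_sub : (circles hW).IsSubcomplex (circlesTop W) :=
  (circleSet_sub hW).preimage_sub (isSubcomplex_prod cwS1.isSubcomplex_univ hW)

/-- The projection `{0} × X ∪ S¹ × W → X`. -/
def circlesProj : GMap (circles hW) X where
  toFun := (fun p => p.1.2 : circleSet W → X)
  continuous := continuous_snd.comp continuous_subtype_val
  map_smul _ _ := rfl

/-- The identification of `S¹ × W`, as a part of `S¹ × W₊`. -/
def circlesTopMap : GMap ((circles hW).sub (circlesTop W) (circlesTop_sub hW))
    (X.sub W hW).plus.circleProd.toGCW where
  toFun := (fun p => (p.1.1.1, Collapse.mk ∅ (⟨p.1.1.2, p.2.2⟩ : W)) :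
    circlesTop W → S1 × Collapse (∅ : Set W))
  continuous := by
    have h : Continuous fun p : circlesTop W => p.1.1 :=
      continuous_subtype_val.comp continuous_subtype_val
    exact h.fst.prodMk (Collapse.continuous_mk.comp (h.snd.subtype_mk _))
  map_smul _ _ := rfl

/-- The map `S¹ × W → S¹ × W₊` with a disjoint base point added to the source. -/
def circlesTopPlus : PtMap ((circles hW).sub (circlesTop W) (circlesTop_sub hW)).plus
    (X.sub W hW).plus.circleProd :=
  quotDesc _ (circlesTopMap hW) fun _ h => h.elim

/-- The retraction of `S¹ × W` onto `{0} × W`. -/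
def circlesTopRetr : GMap ((circles hW).sub (circlesTop W) (circlesTop_sub hW))
    ((circles hW).sub (circlesTop W) (circlesTop_sub hW)) where
  toFun := (fun p => ⟨⟨(0, p.1.1.2), Or.inl ⟨rfl, trivial⟩⟩, trivial, p.2.2⟩ :
    circlesTop W → circlesTop W)
  continuous := by
    have h : Continuous fun p : circlesTop W => p.1.1 :=
      continuous_subtype_val.comp continuous_subtype_val
    exact ((continuous_const.prodMk h.snd).subtype_mk _).subtype_mk _
  map_smul _ _ := rfl

/-- The map `({0} × X ∪ S¹ × W)₊ → S¹ ∧ W₊` that collapses `{0} × X`. -/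
noncomputable def circlesToSusp : PtMap (circles hW).plus (X.sub W hW).plus.susp :=
  extend (circlesBase_sub hW) (circlesTop_sub hW)
    (fun p => (show circleSet W from p).2.imp (fun h => h) fun h => h)
    isSubcomplex_empty (Set.empty_subset _)
    (GMap.comp (X.sub W hW).plus.toSusp.toGMap (circlesTopMap hW))
    (fun _ _ hx => Collapse.mk_eq_pt.mpr (Or.inl ⟨hx.1, trivial⟩))

theorem circlesToSusp_of_mem (p : circleSet W) (hp : p.1.2 ∈ W) :
    (circlesToSusp hW).toFun (Collapse.mk ∅ p) = Collapse.mk (X.sub W hW).plus.wedge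
      (p.1.1, Collapse.mk ∅ (⟨p.1.2, hp⟩ : W)) :=
  extendFun_of_mem (hV := circlesTop_sub hW)
    (GMap.comp (X.sub W hW).plus.toSusp.toGMap (circlesTopMap hW)) ⟨trivial, hp⟩

theorem circlesToSusp_of_zero (p : circleSet W) (hp : p.1.1 = 0) :
    (circlesToSusp hW).toFun (Collapse.mk ∅ p) = (X.sub W hW).plus.susp.base := by
  refine extendFun_eq_base (hV := circlesTop_sub hW)
    (f := GMap.comp (X.sub W hW).plus.toSusp.toGMap (circlesTopMap hW)) fun _ => ?_
  exact Collapse.mk_eq_pt.mpr (Or.inl ⟨hp, trivial⟩)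

theorem circlesToSusp_comp_incl :
    (circlesToSusp hW).comp (plusMap ((circles hW).incl _ (circlesTop_sub hW))) =
      (X.sub W hW).plus.toSusp.comp (circlesTopPlus hW) :=
  quot_ext fun p => circlesToSusp_of_mem hW p.1 p.2.2

theorem proj_circlesTopPlus :
    (plusMap (X.incl W hW)).comp ((X.sub W hW).plus.proj.comp (circlesTopPlus hW)) =
      (plusMap (circlesProj hW)).comp (plusMap ((circles hW).incl _ (circlesTop_sub hW))) :=
  quot_ext fun _ => rfl

end Circles

/-! ### Factorization of the connecting map through the attached circles. -/

section Triad

variable (hU : X.IsSubcomplex U) (hV : X.IsSubcomplex V) (hUV : ∀ x, x ∈ U ∨ x ∈ V)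
  (R : CylinderRetraction X U)

/-- The map `X → {0} × X ∪ S¹ × (U ∩ V)`, homotopic to the inclusion of `{0} × X`, that is given on
`V` by the bottom of the cylinder retraction. -/
def toCircles : GMap X (circles (hU.inter hV)) where
  toFun := (fun x => ⟨((((R.toFun (0, x)).1 : ℝ) : S1), (R.toFun (0, x)).2), by
    rcases R.mem (0, x) with h | h
    · refine Or.inl ⟨?_, trivial⟩
      show (((R.toFun (0, x)).1 : ℝ) : S1) = 0
      rw [h]
      exact AddCircle.coe_period (1 : ℝ)
    · rcases hUV x with hx | hx
      · refine Or.inl ⟨?_, trivial⟩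
        show (((R.toFun (0, x)).1 : ℝ) : S1) = 0
        rw [R.map_mem 0 x hx]
        exact AddCircle.coe_zero (p := (1 : ℝ))
      · exact Or.inr ⟨trivial, h, R.mem_of_isSubcomplex V hV 0 x hx⟩⟩ : X → circleSet (U ∩ V))
  continuous := by
    have h : Continuous fun x : X => R.toFun (0, x) := R.continuous.comp (by fun_prop)
    exact (((AddCircle.continuous_mk' 1).comp (continuous_subtype_val.comp h.fst)).prodMk
      h.snd).subtype_mk _
  map_smul g x := by
    have h := R.map_smul 0 g x
    exact Subtype.ext (Prod.ext (congrArg (fun p => ((p.1 : ℝ) : S1)) h :) (congrArg Prod.snd h :))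

/-- The projection forgets the circle coordinate, leaving the second coordinate of `R(0, x)`; the
homotopy moves `0` to `1`. -/
theorem circlesProj_toCircles_homotopic :
    ((plusMap (circlesProj (hU.inter hV))).comp
      (plusMap (toCircles hU hV hUV R))).Homotopic (PtMap.id X.plus) := by
  let q := X.quotMk ∅ isSubcomplex_empty
  refine quot_homotopic (fun p => q.toFun (R.toFun p).2) (q.continuous.comp R.continuous.snd)
    (fun t g x => ?_) (fun _ _ h => h.elim) (fun x => rfl) (fun x => ?_)
  · exact (congrArg q.toFun (congrArg Prod.snd (R.map_smul t g x))).trans (q.map_smul g _)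
  · rw [R.map_one]
    rfl

/-- The map `X/U → S¹ ∧ (U ∩ V)₊` that induces the connecting map. -/
noncomputable def quotToSusp : PtMap (X.quot U hU) (X.sub (U ∩ V) (hU.inter hV)).plus.susp :=
  (coneToSusp hV (hU.inter hV)).comp
    ((quotToCone hV (hU.inter hV) (R.restrict hV)).comp (excisionInv hU hV hUV))

/-- Both sides use the same retraction `R`, so they agree exactly and not merely up to homotopy:
each sends `x ∈ V` to `t ∧ w` when `R(0, x) = (t, w)` with `w ∈ U ∩ V`. All other points have height
`0` or `1`, and go to the base point. -/
theorem circlesToSusp_comp_toCircles :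
    (circlesToSusp (hU.inter hV)).comp (plusMap (toCircles hU hV hUV R)) =
      (quotToSusp hU hV hUV R).comp
        (quotMap isSubcomplex_empty hU (GMap.id X) fun _ h => h.elim) := by
  refine quot_ext fun x => ?_
  let d : circleSet (U ∩ V) := (toCircles hU hV hUV R).toFun x
  show (circlesToSusp (hU.inter hV)).toFun (Collapse.mk ∅ d) =
    ((coneToSusp hV (hU.inter hV)).comp (quotToCone hV (hU.inter hV) (R.restrict hV))).toFun
      ((excisionInv hU hV hUV).toFun (Collapse.mk U x))
  by_cases hx : x ∈ V
  · have h1 : (excisionInv hU hV hUV).toFun (Collapse.mk U x) =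
        Collapse.mk (Subtype.val ⁻¹' (U ∩ V)) (⟨x, hx⟩ : V) := extendFun_of_mem _ hx
    rw [h1]
    let c : coneSet V (U ∩ V) := cylToConeSet hV (R.restrict hV) (0, (⟨x, hx⟩ : V))
    show _ = coneToSuspFun (hU.inter hV) c
    by_cases hd : (R.toFun (0, x)).2 ∈ U ∩ V
    · exact (circlesToSusp_of_mem _ d hd).trans (coneToSuspFun_of_mem (hU.inter hV) (p := c) hd).symm
    · have h0 : (((R.toFun (0, x)).1 : ℝ) : S1) = 0 := by
        rw [(R.mem (0, x)).resolve_right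
          fun h => hd ⟨h, R.mem_of_isSubcomplex V hV 0 x hx⟩]
        exact AddCircle.coe_period (1 : ℝ)
      exact (circlesToSusp_of_zero _ d h0).trans (coneToSuspFun_of_end (hU.inter hV) (p := c) h0).symm
  · have hxU := (hUV x).resolve_right hx
    have h1 : (excisionInv hU hV hUV).toFun (Collapse.mk U x) =
        (subquot hV (hU.inter hV)).base := extendFun_of_notMem _ hx
    rw [h1, PtMap.map_base]
    refine circlesToSusp_of_zero _ d ?_
    show (((R.toFun (0, x)).1 : ℝ) : S1) = 0
    rw [R.map_mem 0 x hxU]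
    exact AddCircle.coe_zero (p := (1 : ℝ))

end Triad

end GCW

/-! ### The connecting map and products. -/

namespace MulCohTheory

variable (E : MulCohTheory.{u, v} G) {X : GCW G}

/-- On `{0} × X ∪ S¹ × W`, the pullback of the suspension is compatible with products. -/
theorem map_circlesToSusp_mul {W : Set X} (hW : X.IsSubcomplex W) (w : E.H (X.sub W hW))
    (x : E.H X) :
    E.map (GCW.circlesToSusp hW) (E.suspIso _ (w * E.res hW x)) =
      E.map (GCW.circlesToSusp hW) (E.suspIso _ w) *
        E.map (GCW.plusMap (GCW.circlesProj hW)) x := by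
  have hbase : ∀ y, E.res (GCW.circlesBase_sub hW) (E.map (GCW.circlesToSusp hW) y) = 0 := by
    intro y
    refine (E.map_comp _ _ y).symm.trans (E.map_eq_zero_of_forall (fun p => ?_) y)
    rcases Collapse.cases p with rfl | ⟨p, -, rfl⟩
    · rfl
    · exact GCW.circlesToSusp_of_zero hW p.1 p.2.1
  -- On `S¹ × W` the suspension class becomes an honest product of pullbacks of `es` and `w`, by the
  -- defining property of the cross product.
  have htop : ∀ w, E.res (GCW.circlesTop_sub hW)
      (E.map (GCW.circlesToSusp hW) (E.suspIso _ w)) =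
      E.map (GCW.circlesTopPlus hW) (E.map (X.sub W hW).plus.projCircle E.es) *
        E.map (GCW.circlesTopPlus hW) (E.map (X.sub W hW).plus.proj w) := by
    intro w
    refine (E.map_map_of_comp_eq (GCW.circlesToSusp_comp_incl hW) (E.suspIso _ w)).trans ?_
    rw [E.suspIso_eq_cross, map_mul]
  have hx : E.map (GCW.circlesTopPlus hW) (E.map (X.sub W hW).plus.proj (E.res hW x)) =
      E.res (GCW.circlesTop_sub hW) (E.map (GCW.plusMap (GCW.circlesProj hW)) x) := by
    rw [← E.map_comp]
    exact E.map_map_of_comp_eq (GCW.proj_circlesTopPlus hW) x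
  rw [← sub_eq_zero]
  refine E.eq_zero_of_res_eq_zero (GCW.circlesBase_sub hW) (GCW.circlesTop_sub hW)
    (fun p => (show GCW.circleSet W from p).2.imp (fun h => h) fun h => h)
    (GCW.circlesTopRetr hW) (fun _ => ⟨rfl, trivial⟩) (fun p hp => ?_) _ ?_ ?_
  · exact Subtype.ext (Subtype.ext (Prod.ext hp.1.symm rfl))
  · refine (map_sub _ _ _).trans ?_
    rw [hbase, zero_sub, neg_eq_zero]
    refine (map_mul _ _ _).trans ?_
    rw [hbase, zero_mul]
  · refine (map_sub _ _ _).trans (sub_eq_zero.mpr ((htop _).trans (Eq.symm ?_)))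
    refine (map_mul _ _ _).trans ?_
    rw [htop, map_mul (E.map (X.sub W hW).plus.proj), map_mul (E.map (GCW.circlesTopPlus hW)), hx,
      mul_assoc]

section Triad

variable {U V : Set X} (hU : X.IsSubcomplex U) (hV : X.IsSubcomplex V)
  (hUV : ∀ x, x ∈ U ∨ x ∈ V) (R : CylinderRetraction X U)

/-- The map `E*(X, U) → E*(X)`. -/
def fromQuot : E.obj (X.quot U hU) →ₙ+* E.H X :=
  E.map (GCW.quotMap GCW.isSubcomplex_empty hU (GMap.id X) fun _ h => h.elim)

/-- The connecting map of the Mayer-Vietoris sequence. -/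
noncomputable def mayerVietoris : E.H (X.sub (U ∩ V) (hU.inter hV)) →+ E.H X :=
  ((E.fromQuot hU).toAddMonoidHom.comp (E.map (GCW.quotToSusp hU hV hUV R)).toAddMonoidHom).comp
    (E.suspIso _).toAddMonoidHom

theorem mayerVietoris_apply (w : E.H (X.sub (U ∩ V) (hU.inter hV))) :
    E.mayerVietoris hU hV hUV R w =
      E.fromQuot hU (E.map (GCW.quotToSusp hU hV hUV R) (E.suspIso _ w)) := rfl

/-- Describes `δ` through an unreduced complex that projects to `X`, where multiplication by the
pullback of `x` makes sense. -/
theorem mayerVietoris_eq (w : E.H (X.sub (U ∩ V) (hU.inter hV))) :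
    E.mayerVietoris hU hV hUV R w =
      E.map (GCW.plusMap (GCW.toCircles hU hV hUV R))
        (E.map (GCW.circlesToSusp (hU.inter hV)) (E.suspIso _ w)) :=
  (E.map_map_of_comp_eq (GCW.circlesToSusp_comp_toCircles hU hV hUV R) _).symm

/-- The relation is the graph of a map because both backward arrows, the collapse of the cone and
excision, induce isomorphisms. In particular the map does not depend on `R`. -/
theorem isMayerVietoris_iff (w : E.H (X.sub (U ∩ V) (hU.inter hV))) (x : E.H X) :
    E.IsMayerVietoris hU hV w x ↔ E.mayerVietoris hU hV hUV R w = x := by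
  have hq : ∀ y, E.map (GCW.quotToSusp hU hV hUV R) y =
      E.map (GCW.excisionInv hU hV hUV) (E.map (GCW.quotToCone hV (hU.inter hV) (R.restrict hV))
        (E.map (GCW.coneToSusp hV (hU.inter hV)) y)) := by
    intro y
    rw [← E.map_comp, ← E.map_comp]
    rfl
  constructor
  · rintro ⟨z, hz, rfl⟩
    have hz' : E.map (GCW.coneToQuot hV (hU.inter hV) Set.inter_subset_right)
        (E.map (GCW.excision hU hV) z) =
          E.map (GCW.coneToSusp hV (hU.inter hV)) (E.suspIso _ w) := hz
    rw [mayerVietoris_apply, hq, ← hz', E.map_quotToCone_coneToQuot,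
      E.map_map_of_comp_eq_id (GCW.excision_comp hU hV hUV)]
    rfl
  · rintro rfl
    refine ⟨E.map (GCW.quotToSusp hU hV hUV R) (E.suspIso _ w), ?_, rfl⟩
    show E.map (GCW.coneToQuot hV (hU.inter hV) Set.inter_subset_right)
      (E.map (GCW.excision hU hV) _) = _
    rw [hq, E.map_map_of_comp_eq_id (GCW.excisionInv_comp hU hV hUV),
      E.map_coneToQuot_quotToCone]

theorem mayerVietoris_mem {n : ℤ} {w : E.H (X.sub (U ∩ V) (hU.inter hV))} (hw : w ∈ E.gr _ n) :
    E.mayerVietoris hU hV hUV R w ∈ E.gr _ (n + 1) :=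
  E.map_mem _ (E.map_mem _ (E.suspIso_mem hw))

theorem mayerVietoris_mul_res (w : E.H (X.sub (U ∩ V) (hU.inter hV))) (x : E.H X) :
    E.mayerVietoris hU hV hUV R (w * E.res (hU.inter hV) x) =
      E.mayerVietoris hU hV hUV R w * x := by
  rw [mayerVietoris_eq, mayerVietoris_eq, map_circlesToSusp_mul, map_mul,
    E.map_map_of_homotopic_id (GCW.circlesProj_toCircles_homotopic hU hV hUV R)]

/-- The class comes from `X/U`, in which `U ∩ V` is collapsed to the base point. -/
theorem res_mayerVietoris (w : E.H (X.sub (U ∩ V) (hU.inter hV))) :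
    E.res (hU.inter hV) (E.mayerVietoris hU hV hUV R w) = 0 := by
  rw [mayerVietoris_apply]
  refine (E.map_comp _ _ _).symm.trans (E.map_eq_zero_of_forall (fun p => ?_) _)
  rcases Collapse.cases p with rfl | ⟨x, -, rfl⟩
  · rfl
  · exact Collapse.mk_eq_pt.mpr x.2.1

/-- An additive property of classes holds if it holds for homogeneous classes. -/
theorem induction_gr {Y : PtGCW G} {p : E.obj Y → Prop} (h0 : p 0)
    (hadd : ∀ x y, p x → p y → p (x + y)) (hgr : ∀ n, ∀ x ∈ E.gr Y n, p x) (x : E.obj Y) : p x := by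
  obtain ⟨v, rfl⟩ := (E.isInternal Y).2 x
  induction v using DirectSum.induction_on with
  | zero => simpa using h0
  | of n y => simpa using hgr n y y.2
  | add v w hv hw => simpa using hadd _ _ hv hw

/-- For `w` of degree `n`, moving `x` to the right of `w` costs `(-1)^(mn)`, and moving it back past
`δ w`, of degree `n + 1`, costs `(-1)^(m(n+1))`. Together this is `(-1)^m`, independent of `n`, so
it extends to all `w` by additivity. -/
theorem mayerVietoris_res_mul {m : ℤ} (w : E.H (X.sub (U ∩ V) (hU.inter hV))) {x : E.H X}
    (hx : x ∈ E.gr _ m) :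
    E.mayerVietoris hU hV hUV R (E.res (hU.inter hV) x * w) =
      m.negOnePow • (x * E.mayerVietoris hU hV hUV R w) := by
  induction w using E.induction_gr with
  | h0 => simp
  | hadd w w' h h' => rw [mul_add, map_add, map_add, mul_add, smul_add, h, h']
  | hgr n w hw =>
    have h1 := E.graded_comm (E.map_mem (GCW.plusMap (X.incl _ (hU.inter hV))) hx) hw
    have h2 := E.graded_comm hx (E.mayerVietoris_mem hU hV hUV R hw)
    have h3 : E.mayerVietoris hU hV hUV R (E.res (hU.inter hV) x * w) =
        (m * n).negOnePow • (E.mayerVietoris hU hV hUV R w * x) := by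
      rw [← mayerVietoris_mul_res]
      refine (congrArg (E.mayerVietoris hU hV hUV R) h1).trans ?_
      rw [Units.smul_def, Units.smul_def, map_zsmul]
      rfl
    rw [h3, h2, smul_smul, ← Int.negOnePow_add]
    congr 1
    rw [show m + m * (n + 1) = m * n + 2 * m by ring, Int.negOnePow_add, Int.negOnePow_two_mul,
      mul_one]

/-- The sign depends on the degree of `x`, so `x` is split into homogeneous parts; each sign is its
own inverse and can be absorbed in the range. -/
theorem mul_mayerVietoris_mem_range (w : E.H (X.sub (U ∩ V) (hU.inter hV))) (x : E.H X) :
    x * E.mayerVietoris hU hV hUV R w ∈ (E.mayerVietoris hU hV hUV R).range := by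
  induction x using E.induction_gr with
  | h0 => rw [zero_mul]; exact zero_mem _
  | hadd x y hx hy => rw [add_mul]; exact add_mem hx hy
  | hgr n x hx =>
    have h := E.mayerVietoris_res_mul hU hV hUV R w hx
    have h' : n.negOnePow • E.mayerVietoris hU hV hUV R (E.res (hU.inter hV) x * w) =
        x * E.mayerVietoris hU hV hUV R w := by
      rw [h, smul_smul, Int.units_mul_self, one_smul]
    rw [← h', Units.smul_def]
    exact AddSubgroup.zsmul_mem _ (AddMonoidHom.mem_range.mpr ⟨_, rfl⟩) _

end Triad

end MulCohTheory

end EquivCoh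

theorem mainTheorem5 {G : Type u} [Group G] [TopologicalSpace G] [IsTopologicalGroup G]
    (E : EquivCoh.MulCohTheory.{u, v} G) (X : EquivCoh.GCW G) (U V : Set X)
    (hU : X.IsSubcomplex U) (hV : X.IsSubcomplex V) (hUV : U ∪ V = Set.univ) :
    ∃ δ : E.H (X.sub (U ∩ V) (hU.inter hV)) →+ E.H X,
      -- `δ` is the connecting map of the Mayer-Vietoris sequence, of degree one
      (∀ w x, E.IsMayerVietoris hU hV w x ↔ δ w = x) ∧
      (∀ n w, w ∈ E.gr _ n → δ w ∈ E.gr _ (n + 1)) ∧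
      -- it is a homomorphism of right modules, and of left modules up to the usual sign
      (∀ w x, δ (w * E.res (hU.inter hV) x) = δ w * x) ∧
      (∀ m w x, x ∈ E.gr _ m → δ (E.res (hU.inter hV) x * w) = m.negOnePow • (x * δ w)) ∧
      -- its image is a two-sided ideal of square zero
      (∀ w x, δ w * x ∈ δ.range ∧ x * δ w ∈ δ.range) ∧
      (∀ w w', δ w * δ w' = 0) := by
  have hUV' : ∀ x, x ∈ U ∨ x ∈ V := fun x => (Set.ext_iff.mp hUV x).mpr trivial
  obtain ⟨R⟩ := hU.nonempty_cylinderRetraction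
  refine ⟨E.mayerVietoris hU hV hUV' R, E.isMayerVietoris_iff hU hV hUV' R,
    fun n w hw => E.mayerVietoris_mem hU hV hUV' R hw, E.mayerVietoris_mul_res hU hV hUV' R,
    fun m w x hx => E.mayerVietoris_res_mul hU hV hUV' R w hx,
    fun w x => ⟨⟨_, E.mayerVietoris_mul_res hU hV hUV' R w x⟩,
      E.mul_mayerVietoris_mem_range hU hV hUV' R w x⟩, fun w w' => ?_⟩
  -- The second factor is treated as the scalar: `δ w * δ w' = δ (w * j*(δ w'))`, and `j* ∘ δ = 0`.
  rw [← E.mayerVietoris_mul_res, E.res_mayerVietoris, mul_zero, map_zero]
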